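/- Fix a set $\{p_i : i\in I\}$ of atomic propositions. A \emph{relational inquisitive model} is a two-sorted structure $\mathfrak M=(W,S,E,\varepsilon,(P_i)_{i\in I})$ with $W,S$ non-empty, $E,\varepsilon\subseteq W\times S$, $P_i\subseteq W$, such that, writing $\underline s=\{w\in W: w\,\varepsilon\, s\}$: (i) $\underline s=\underline{s'}$ implies $s=s'$; (ii) every subset of $\underline s$ is of the form $\underline{s'}$ with $s'\in S$; (iii) $E[w]\neq\emptyset$ for all $w\in W$; (iv) $s\in E[w]$ and $\underline{s'}\subseteq\underline s$ imply $s'\in E[w]$. It is \emph{finite} if $W$ and $S$ are finite, and \emph{locally full} if for every $w\in W$ every subset of $\bigcup\{\underline s: s\in E[w]\}$ is of the form $\underline{t}$ with $t\in S$. It determines the inquisitive modal model $\mathfrak M^*$ with worlds $W$, $\Sigma(w)=\{\underline s: s\in E[w]\}$ and $V(p_i)=P_i$. Formulae of InqML, $\varphi::=p_i\mid\bot\mid\varphi\wedge\varphi\mid\varphi\to\varphi\mid\varphi\mathbin{\rotatebox[origin=c]{-90}{$\geqslant$}}\varphi\mid\square\varphi\mid\boxplus\varphi$, are evaluated at information states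 $s\subseteq W$: $s\models p_i$ iff $s\subseteq V(p_i)$; $s\models\bot$ iff $s=\emptyset$; $\wedge$ and $\mathbin{\rotatebox[origin=c]{-90}{$\geqslant$}}$ are interpreted as "and" and "or"; $s\models\varphi\to\psi$ iff every $t\subseteq s$ with $t\models\varphi$ satisfies $t\models\psi$; $s\models\square\varphi$ iff $\bigcup\Sigma(w)\models\varphi$ for all $w\in s$; $s\models\boxplus\varphi$ iff $t\models\varphi$ for all $w\in s$ and $t\in\Sigma(w)$. A formula is true at a world $w$ iff $\{w\}$ supports it. FO is two-sorted first-order logic with equality in the relations $E,\varepsilon,P_i$. A bisimulation between two such models $\mathfrak M,\mathfrak M'$ is a relation $Z\subseteq (W\times W')\cup(\wp(W)\times\wp(W'))$ such that: if $wZw'$, then $w,w'$ satisfy the same atoms, every $s\in\Sigma(w)$ is $Z$-related to some $s'\in\Sigma'(w')$, and vice versa; if $sZs'$, then every $w\in s$ is $Z$-related to some $w'\in s'$, and vice versa. Worlds are bisimilar ($\sim$) if some bisimulation relates them; information states $s,s'$ are bisimilar if every world of $s$ is bisimilar to some world of $s'$ and vice versa. \textbf{Theorem.} Let $\mathcal C$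 be one of the following classes of relational inquisitive models: all models; finite models; locally full models; finite locally full models. Then: (a) A property of world-pointed models $(\mathfrak M,w)$, $w\in W$, is definable over $\mathcal C$ by (truth of) an InqML-formula if and only if it is definable over $\mathcal C$ by an FO-formula $\varphi(\mathtt w)$ in a single free world variable and is $\sim$-invariant over $\mathcal C$. (b) A property of state-pointed models $(\mathfrak M,s)$, $s\in S$, is definable over $\mathcal C$ by (support of) an InqML-formula if and only if it is definable over $\mathcal C$ by an FO-formula $\varphi(\mathtt s)$ in a single free state variable, is satisfied by at least one state-pointed model in $\mathcal C$, is downward closed over $\mathcal C$ (if $\mathfrak M\in\mathcal C$, $(\mathfrak M,s)$ has the property and $\underline t\subseteq\underline s$, then $(\mathfrak M,t)$ has it), and is $\sim$-invariant over $\mathcal C$. -/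

import Mathlib

universe u v

namespace Inq

/-- Formulae of inquisitive modal logic over atomic propositions indexed by `I`.
`idisj` is inquisitive disjunction, `box` is `□`, `wbox` is `⊞`. -/
inductive Form (I : Type v) : Type v
  | atom : I → Form I
  | bot : Form I
  | and : Form I → Form I → Form I
  | imp : Form I → Form I → Form I
  | idisj : Form I → Form I → Form I
  | box : Form I → Form I
  | wbox : Form I → Form I

/-- Inquisitive modal models: each world is assigned an inquisitive state, i.e. a non-empty
downward closed set of information states. -/
structure Model (I : Type v) where
  W : Type u
  Sig : W → Set (Set W)
  sig_nonempty : ∀ w, (Sig w).Nonempty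
  sig_down : ∀ w s t, s ∈ Sig w → t ⊆ s → t ∈ Sig w
  V : I → Set W

namespace Model

variable {I : Type v}

/-- `σ(w) = ⋃ Σ(w)`. -/
def sigma (M : Model.{u, v} I) (w : M.W) : Set M.W := ⋃₀ M.Sig w

/-- Support of a formula at an information state. -/
def Supports (M : Model.{u, v} I) : Set M.W → Form I → Prop
  | s, .atom p => s ⊆ M.V p
  | s, .bot => s = ∅
  | s, .and φ ψ => M.Supports s φ ∧ M.Supports s ψ
  | s, .imp φ ψ => ∀ t, t ⊆ s → M.Supports t φ → M.Supports t ψ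
  | s, .idisj φ ψ => M.Supports s φ ∨ M.Supports s ψ
  | s, .box φ => ∀ w ∈ s, M.Supports (M.sigma w) φ
  | s, .wbox φ => ∀ w ∈ s, ∀ t ∈ M.Sig w, M.Supports t φ

/-- Truth of a formula at a world: support at the singleton state. -/
def Truth (M : Model.{u, v} I) (w : M.W) (φ : Form I) : Prop := M.Supports {w} φ

/-- Inquisitive bisimulations, given by their world part `ZW` and their state part `ZS`. -/
structure IsBisimulation (M N : Model.{u, v} I) (ZW : M.W → N.W → Prop)
    (ZS : Set M.W → Set N.W → Prop) : Prop where
  atoms : ∀ w w', ZW w w' → ∀ p, w ∈ M.V p ↔ w' ∈ N.V p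
  state_forth : ∀ s s', ZS s s' → ∀ w ∈ s, ∃ w' ∈ s', ZW w w'
  state_back : ∀ s s', ZS s s' → ∀ w' ∈ s', ∃ w ∈ s, ZW w w'
  world_forth : ∀ w w', ZW w w' → ∀ s ∈ M.Sig w, ∃ s' ∈ N.Sig w', ZS s s'
  world_back : ∀ w w', ZW w w' → ∀ s' ∈ N.Sig w', ∃ s ∈ M.Sig w, ZS s s'

/-- Bisimilarity of world-pointed models. -/
def WorldBisim (M : Model.{u, v} I) (w : M.W) (N : Model.{u, v} I) (w' : N.W) : Prop :=
  ∃ ZW ZS, IsBisimulation M N ZW ZS ∧ ZW w w'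

/-- Bisimilarity of state-pointed models. -/
def StateBisim (M : Model.{u, v} I) (s : Set M.W) (N : Model.{u, v} I) (s' : Set N.W) : Prop :=
  (∀ w ∈ s, ∃ w' ∈ s', WorldBisim M w N w') ∧ (∀ w' ∈ s', ∃ w ∈ s, WorldBisim M w N w')

end Model

/-- Relational inquisitive modal models: two-sorted structures `(W, S, E, ε, (P i))`. -/
structure RelModel (I : Type v) where
  W : Type u
  S : Type u
  E : W → S → Prop
  eps : W → S → Prop
  P : I → W → Prop
  nonempty_W : Nonempty W
  nonempty_S : Nonempty S
  extensionality : ∀ s s' : S, {w | eps w s} = {w | eps w s'} → s = s'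
  local_powerset : ∀ (s : S) (t : Set W), t ⊆ {w | eps w s} → ∃ s' : S, {w | eps w s'} = t
  nonemptiness : ∀ w, ∃ s, E w s
  downward_closure : ∀ w s s', E w s → {v | eps v s'} ⊆ {v | eps v s} → E w s'

namespace RelModel

variable {I : Type v}

/-- The set of worlds associated with an element of the second sort. -/
def ext (M : RelModel.{u, v} I) (s : M.S) : Set M.W := {w | M.eps w s}

/-- `R[w] = ⋃ E[w]`. -/
def R (M : RelModel.{u, v} I) (w : M.W) : Set M.W := {v | ∃ s, M.E w s ∧ M.eps v s}

/-- Local fullness: `℘(R[w]) ⊆ S` for all `w`. -/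
def LocallyFull (M : RelModel.{u, v} I) : Prop :=
  ∀ (w : M.W) (t : Set M.W), t ⊆ M.R w → ∃ s : M.S, M.ext s = t

/-- Finiteness of both sorts. -/
def IsFinite (M : RelModel.{u, v} I) : Prop := Finite M.W ∧ Finite M.S

/-- The inquisitive modal model `M*` determined by a relational model `M`. -/
def star (M : RelModel.{u, v} I) : Model.{u, v} I where
  W := M.W
  Sig w := {t | ∃ s, M.E w s ∧ M.ext s = t}
  sig_nonempty w := by
    obtain ⟨s, hs⟩ := M.nonemptiness w
    exact ⟨M.ext s, s, hs, rfl⟩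
  sig_down w s t := by
    rintro ⟨x, hx, rfl⟩ hts
    obtain ⟨y, hy⟩ := M.local_powerset x t hts
    refine ⟨y, M.downward_closure w x y hx ?_, hy⟩
    rw [hy]
    exact hts
  V p := {w | M.P p w}

end RelModel

/-- First-order formulae of the two-sorted relational language with equality, with free variables
among `m` variables for worlds and `n` variables for states. The quantifiers bind the last
variable of the respective sort. -/
inductive FO (I : Type v) : ℕ → ℕ → Type v
  | pred {m n : ℕ} : I → Fin m → FO I m n
  | relE {m n : ℕ} : Fin m → Fin n → FO I m n
  | relEps {m n : ℕ} : Fin m → Fin n → FO I m n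
  | eqW {m n : ℕ} : Fin m → Fin m → FO I m n
  | eqS {m n : ℕ} : Fin n → Fin n → FO I m n
  | falsum {m n : ℕ} : FO I m n
  | imp {m n : ℕ} : FO I m n → FO I m n → FO I m n
  | allW {m n : ℕ} : FO I (m + 1) n → FO I m n
  | allS {m n : ℕ} : FO I m (n + 1) → FO I m n

/-- Tarskian satisfaction in a relational model, under assignments of worlds and states. -/
def FO.Sat {I : Type v} (M : RelModel.{u, v} I) :
    {m n : ℕ} → FO I m n → (Fin m → M.W) → (Fin n → M.S) → Prop
  | _, _, .pred i x, a, _ => M.P i (a x)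
  | _, _, .relE x y, a, b => M.E (a x) (b y)
  | _, _, .relEps x y, a, b => M.eps (a x) (b y)
  | _, _, .eqW x y, a, _ => a x = a y
  | _, _, .eqS x y, _, b => b x = b y
  | _, _, .falsum, _, _ => False
  | _, _, .imp φ ψ, a, b => FO.Sat M φ a b → FO.Sat M ψ a b
  | _, _, .allW φ, a, b => ∀ w : M.W, FO.Sat M φ (Fin.snoc a w) b
  | _, _, .allS φ, a, b => ∀ s : M.S, FO.Sat M φ a (Fin.snoc b s)

/-- Names for the four classes of relational models. -/
inductive ModelClass
  | all
  | finite
  | locallyFull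
  | finiteLocallyFull

/-- Membership of a relational model in one of the four classes. -/
def ModelClass.Contains {I : Type v} : ModelClass → RelModel.{u, v} I → Prop
  | .all, _ => True
  | .finite, M => M.IsFinite
  | .locallyFull, M => M.LocallyFull
  | .finiteLocallyFull, M => M.IsFinite ∧ M.LocallyFull

/-- Properties of world-pointed relational models. -/
abbrev WorldProperty (I : Type v) : Type (max (u + 1) v) := (M : RelModel.{u, v} I) → M.W → Prop

/-- Properties of state-pointed relational models. -/
abbrev StateProperty (I : Type v) : Type (max (u + 1) v) := (M : RelModel.{u, v} I) → M.S → Prop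

namespace WorldProperty

variable {I : Type v}

def InqDefinable (C : ModelClass) (Q : WorldProperty.{u, v} I) : Prop :=
  ∃ φ : Form I, ∀ M : RelModel.{u, v} I, C.Contains M → ∀ w : M.W,
    Q M w ↔ M.star.Truth w φ

def FODefinable (C : ModelClass) (Q : WorldProperty.{u, v} I) : Prop :=
  ∃ φ : FO I 1 0, ∀ M : RelModel.{u, v} I, C.Contains M → ∀ w : M.W,
    Q M w ↔ φ.Sat M ![w] ![]

def BisimInvariant (C : ModelClass) (Q : WorldProperty.{u, v} I) : Prop :=
  ∀ M N : RelModel.{u, v} I, C.Contains M → C.Contains N → ∀ (w : M.W) (w' : N.W),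
    Model.WorldBisim M.star w N.star w' → (Q M w ↔ Q N w')

end WorldProperty

namespace StateProperty

variable {I : Type v}

def InqDefinable (C : ModelClass) (Q : StateProperty.{u, v} I) : Prop :=
  ∃ φ : Form I, ∀ M : RelModel.{u, v} I, C.Contains M → ∀ s : M.S,
    Q M s ↔ M.star.Supports (M.ext s) φ

def FODefinable (C : ModelClass) (Q : StateProperty.{u, v} I) : Prop :=
  ∃ φ : FO I 0 1, ∀ M : RelModel.{u, v} I, C.Contains M → ∀ s : M.S,
    Q M s ↔ φ.Sat M ![] ![s]

def BisimInvariant (C : ModelClass) (Q : StateProperty.{u, v} I) : Prop :=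
  ∀ M N : RelModel.{u, v} I, C.Contains M → C.Contains N → ∀ (s : M.S) (s' : N.S),
    Model.StateBisim M.star (M.ext s) N.star (N.ext s') → (Q M s ↔ Q N s')

def DownwardClosed (C : ModelClass) (Q : StateProperty.{u, v} I) : Prop :=
  ∀ M : RelModel.{u, v} I, C.Contains M → ∀ s t : M.S, M.ext t ⊆ M.ext s → Q M s → Q M t

/-- Some state-pointed model in the class has the property. -/
def NonemptyOver (C : ModelClass) (Q : StateProperty.{u, v} I) : Prop :=
  ∃ M : RelModel.{u, v} I, C.Contains M ∧ ∃ s : M.S, Q M s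

end StateProperty

end Inq

namespace Inq

variable {I : Type v}

/-! ### Persistence, bisimulation invariance and truth-conditional formulae -/

namespace Model

/-! From InqML to FO: support is persistent, bisimulation invariant and trivial at the empty state.
Every formula is equivalent to a finite inquisitive disjunction of first-order conditions on single
worlds (`exists_list_supports_iff`), so first-order quantification over states is needed only for
the modalities.

From FO to InqML, the crux is that a bisimulation invariant first-order property is already
invariant under `n`-round bisimilarity over a finite set `J` of atoms
(`StateProperty.exists_invariant_tp`). Let `φ` have quantifier rank `q`, let `J` be its atoms and `n
= 2 ^ q + 1`. Replace a model by many disjoint copies of a version stratified into layers `0, …, n`,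
where the inquisitive state of a world lives in the next layer. In some copies the last layer leads
back to itself; these are bisimilar to the original model over `J`. In the others it is cut off, so
that bisimilarity from layer `0` is governed by types of level `n`. Both kinds lie in one structure,
and in `q` rounds of the Ehrenfeucht–Fraïssé game the first layer is too far from the last for the
kinds to be told apart (`FO.sat_layered_iff`). Duplicator changes only the copy, never the layer or
the element of the original model, so second-sort elements need no analysis. The construction
preserves finiteness and local fullness, which gives all four classes at once.

There are finitely many types of level `n` over `J`, each definable by truth of a formula
(`TruthDefinable.tp_eq`). A nonempty downward closed property of states is then expressed by an
inquisitive disjunction over the sets of types realised by its instances. World properties reduce to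
state properties through singleton states. -/

theorem supports_empty (M : Model.{u, v} I) (φ : Form I) : M.Supports ∅ φ := by
  induction φ with
  | atom p => exact Set.empty_subset _
  | bot => rfl
  | and φ ψ h₁ h₂ => exact ⟨h₁, h₂⟩
  | imp φ ψ h₁ h₂ =>
    intro t ht _
    rw [Set.subset_empty_iff.1 ht]
    exact h₂
  | idisj φ ψ h₁ h₂ => exact Or.inl h₁
  | box φ h => intro w hw; exact hw.elim
  | wbox φ h => intro w hw; exact hw.elim

theorem Supports.mono {M : Model.{u, v} I} {φ : Form I} {s t : Set M.W}
    (h : M.Supports s φ) (hts : t ⊆ s) : M.Supports t φ := by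
  induction φ generalizing s t with
  | atom p => exact hts.trans h
  | bot => exact Set.subset_empty_iff.1 (hts.trans (Set.Subset.trans (le_of_eq h) le_rfl))
  | and φ ψ h₁ h₂ => exact ⟨h₁ h.1 hts, h₂ h.2 hts⟩
  | imp φ ψ h₁ h₂ => intro r hr; exact h r (hr.trans hts)
  | idisj φ ψ h₁ h₂ => exact h.imp (fun h => h₁ h hts) (fun h => h₂ h hts)
  | box φ ih => intro w hw; exact h w (hts hw)
  | wbox φ ih => intro w hw; exact h w (hts hw)

theorem empty_mem_Sig (M : Model.{u, v} I) (w : M.W) : ∅ ∈ M.Sig w := by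
  obtain ⟨s, hs⟩ := M.sig_nonempty w
  exact M.sig_down w s ∅ hs (Set.empty_subset s)

theorem WorldBisim.symm {M N : Model.{u, v} I} {w : M.W} {w' : N.W}
    (h : WorldBisim M w N w') : WorldBisim N w' M w := by
  obtain ⟨ZW, ZS, h, hw⟩ := h
  exact ⟨fun x y => ZW y x, fun x y => ZS y x,
    { atoms := fun x y hxy p => (h.atoms y x hxy p).symm
      state_forth := fun s t hst => h.state_back t s hst
      state_back := fun s t hst => h.state_forth t s hst
      world_forth := fun x y hxy => h.world_back y x hxy
      world_back := fun x y hxy => h.world_forth y x hxy }, hw⟩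

theorem StateBisim.symm {M N : Model.{u, v} I} {s : Set M.W} {s' : Set N.W}
    (h : StateBisim M s N s') : StateBisim N s' M s :=
  ⟨fun w hw => (h.2 w hw).imp fun _ h => ⟨h.1, h.2.symm⟩,
    fun w hw => (h.1 w hw).imp fun _ h => ⟨h.1, h.2.symm⟩⟩

theorem WorldBisim.stateBisim_singleton {M N : Model.{u, v} I} {w : M.W} {w' : N.W}
    (h : WorldBisim M w N w') : StateBisim M {w} N {w'} := by
  refine ⟨?_, ?_⟩
  · rintro _ rfl; exact ⟨w', rfl, h⟩
  · rintro _ rfl; exact ⟨w, rfl, h⟩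

theorem WorldBisim.atoms {M N : Model.{u, v} I} {w : M.W} {w' : N.W}
    (h : WorldBisim M w N w') (p : I) : w ∈ M.V p ↔ w' ∈ N.V p := by
  obtain ⟨ZW, ZS, h, hw⟩ := h
  exact h.atoms w w' hw p

theorem WorldBisim.forth {M N : Model.{u, v} I} {w : M.W} {w' : N.W}
    (h : WorldBisim M w N w') {s : Set M.W} (hs : s ∈ M.Sig w) :
    ∃ s' ∈ N.Sig w', StateBisim M s N s' := by
  obtain ⟨ZW, ZS, h, hw⟩ := h
  obtain ⟨s', hs', hZ⟩ := h.world_forth w w' hw s hs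
  refine ⟨s', hs', fun x hx => ?_, fun x hx => ?_⟩
  · obtain ⟨y, hy, hxy⟩ := h.state_forth s s' hZ x hx
    exact ⟨y, hy, ZW, ZS, h, hxy⟩
  · obtain ⟨y, hy, hxy⟩ := h.state_back s s' hZ x hx
    exact ⟨y, hy, ZW, ZS, h, hxy⟩

theorem WorldBisim.sigma {M N : Model.{u, v} I} {w : M.W} {w' : N.W}
    (h : WorldBisim M w N w') : StateBisim M (M.sigma w) N (N.sigma w') := by
  constructor
  · rintro x ⟨s, hs, hx⟩
    obtain ⟨s', hs', hb⟩ := h.forth hs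
    obtain ⟨y, hy, hxy⟩ := hb.1 x hx
    exact ⟨y, ⟨s', hs', hy⟩, hxy⟩
  · rintro x ⟨s, hs, hx⟩
    obtain ⟨s', hs', hb⟩ := h.symm.forth hs
    obtain ⟨y, hy, hxy⟩ := hb.1 x hx
    exact ⟨y, ⟨s', hs', hy⟩, hxy.symm⟩

/-- This provides the matching of substates needed for implication. -/
theorem StateBisim.subset {M N : Model.{u, v} I} {s : Set M.W} {s' : Set N.W}
    (h : StateBisim M s N s') {t : Set M.W} (ht : t ⊆ s) :
    ∃ t' ⊆ s', StateBisim M t N t' := by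
  refine ⟨{y | y ∈ s' ∧ ∃ x ∈ t, WorldBisim M x N y}, fun y hy => hy.1, fun x hx => ?_,
    fun y hy => hy.2⟩
  obtain ⟨y, hy, hxy⟩ := h.1 x (ht hx)
  exact ⟨y, ⟨hy, x, hx, hxy⟩, hxy⟩

theorem StateBisim.supports_iff {M N : Model.{u, v} I} {s : Set M.W} {s' : Set N.W}
    (h : StateBisim M s N s') (φ : Form I) : M.Supports s φ ↔ N.Supports s' φ := by
  -- Implication transfers its antecedent in the opposite direction, so the induction hypothesis
  -- must cover both orders of the models.
  suffices H : ∀ (M N : Model.{u, v} I) (s : Set M.W) (s' : Set N.W),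
      StateBisim M s N s' → M.Supports s φ → N.Supports s' φ from
    ⟨H M N s s' h, H N M s' s h.symm⟩
  clear h s s' M N
  induction φ with
  | atom p =>
    intro M N s s' h hs y hy
    obtain ⟨x, hx, hxy⟩ := h.2 y hy
    exact (hxy.atoms p).1 (hs hx)
  | bot =>
    intro M N s s' h hs
    refine Set.eq_empty_of_forall_notMem fun y hy => ?_
    obtain ⟨x, hx, -⟩ := h.2 y hy
    have hs : s = ∅ := hs
    rw [hs] at hx
    exact hx
  | and φ ψ h₁ h₂ =>
    intro M N s s' h hs
    exact ⟨h₁ M N s s' h hs.1, h₂ M N s s' h hs.2⟩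
  | imp φ ψ h₁ h₂ =>
    intro M N s s' h hs t' ht' hφ
    obtain ⟨t, ht, hb⟩ := h.symm.subset ht'
    exact h₂ M N t t' hb.symm (hs t ht (h₁ N M t' t hb hφ))
  | idisj φ ψ h₁ h₂ =>
    intro M N s s' h hs
    exact hs.imp (h₁ M N s s' h) (h₂ M N s s' h)
  | box φ ih =>
    intro M N s s' h hs y hy
    obtain ⟨x, hx, hxy⟩ := h.2 y hy
    exact ih M N _ _ hxy.sigma (hs x hx)
  | wbox φ ih =>
    intro M N s s' h hs y hy t' ht'
    obtain ⟨x, hx, hxy⟩ := h.2 y hy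
    obtain ⟨t, ht, hb⟩ := hxy.symm.forth ht'
    exact ih M N t t' hb.symm (hs x hx t ht)

theorem WorldBisim.truth_iff {M N : Model.{u, v} I} {w : M.W} {w' : N.W}
    (h : WorldBisim M w N w') (φ : Form I) : M.Truth w φ ↔ N.Truth w' φ :=
  h.stateBisim_singleton.supports_iff φ

end Model

namespace Form

/-- Negation. -/
def neg (φ : Form I) : Form I := .imp φ .bot

/-- Conjunction of a list of formulae. -/
def conj : List (Form I) → Form I
  | [] => neg .bot
  | φ :: l => .and φ (conj l)

/-- Inquisitive disjunction of a list of formulae. -/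
def disj : List (Form I) → Form I
  | [] => .bot
  | φ :: l => .idisj φ (disj l)

/-- By persistence, a nonempty substate supporting `φ` yields a world where `φ` is true. Negations
are therefore truth-conditional, and double negation turns any formula into its truth-conditional
version. -/
theorem supports_neg (M : Model.{u, v} I) (s : Set M.W) (φ : Form I) :
    M.Supports s φ.neg ↔ ∀ w ∈ s, ¬ M.Truth w φ := by
  constructor
  · intro h w hw hφ
    exact Set.singleton_ne_empty w (h {w} (Set.singleton_subset_iff.2 hw) hφ)
  · intro h t ht hφ
    refine Set.eq_empty_of_forall_notMem fun w hw => h w (ht hw) ?_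
    exact Model.Supports.mono hφ (Set.singleton_subset_iff.2 hw)

theorem truth_neg (M : Model.{u, v} I) (w : M.W) (φ : Form I) :
    M.Truth w φ.neg ↔ ¬ M.Truth w φ := by
  refine (supports_neg M {w} φ).trans ?_
  simp

theorem supports_neg_neg (M : Model.{u, v} I) (s : Set M.W) (φ : Form I) :
    M.Supports s φ.neg.neg ↔ ∀ w ∈ s, M.Truth w φ := by
  simp [supports_neg M s, truth_neg]

theorem truth_wbox (M : Model.{u, v} I) (w : M.W) (φ : Form I) :
    M.Truth w φ.wbox ↔ ∀ t ∈ M.Sig w, M.Supports t φ := by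
  simp [Model.Truth, Model.Supports]

theorem supports_conj (M : Model.{u, v} I) (s : Set M.W) (l : List (Form I)) :
    M.Supports s (conj l) ↔ ∀ φ ∈ l, M.Supports s φ := by
  induction l with
  | nil =>
    refine iff_of_true ?_ (by simp)
    exact fun t _ h => h
  | cons φ l ih =>
    rw [List.forall_mem_cons, ← ih]
    exact Iff.rfl

theorem supports_disj (M : Model.{u, v} I) (s : Set M.W) (l : List (Form I)) :
    M.Supports s (disj l) ↔ s = ∅ ∨ ∃ φ ∈ l, M.Supports s φ := by
  induction l with
  | nil => simp [disj, Model.Supports]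
  | cons φ l ih =>
    have h : M.Supports s (disj (φ :: l)) ↔ M.Supports s φ ∨ M.Supports s (disj l) := Iff.rfl
    rw [h, ih, List.exists_mem_cons_iff]
    tauto

end Form

/-! ### Definability of finite bisimulation types -/

/-- Types of worlds up to `n` rounds of the bisimulation game, over the atoms in `J`. -/
def Ty (J : Set I) : ℕ → Type v
  | 0 => Set J
  | n + 1 => Set J × Set (Set (Ty J n))

theorem Ty.finite {J : Set I} (hJ : J.Finite) (n : ℕ) : Finite (Ty J n) := by
  have := hJ.to_subtype
  induction n with
  | zero => exact inferInstanceAs (Finite (Set J))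
  | succ n ih => exact inferInstanceAs (Finite (Set J × Set (Set (Ty J n))))

namespace Model

/-- The atoms in `J` true at a world. -/
def atomsAt (M : Model.{u, v} I) (J : Set I) (w : M.W) : Set J := {p | w ∈ M.V p}

/-- The type of a world of level `n`. -/
def tp (M : Model.{u, v} I) (J : Set I) : (n : ℕ) → M.W → Ty J n
  | 0, w => M.atomsAt J w
  | n + 1, w => (M.atomsAt J w, {X | ∃ s ∈ M.Sig w, X = M.tp J n '' s})

theorem atomsAt_eq_of_tp_eq {M N : Model.{u, v} I} {J : Set I} {n : ℕ} {w : M.W} {w' : N.W}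
    (h : M.tp J n w = N.tp J n w') : M.atomsAt J w = N.atomsAt J w' := by
  cases n with
  | zero => exact h
  | succ n => exact congrArg Prod.fst h

theorem exists_mem_Sig_of_tp_eq {M N : Model.{u, v} I} {J : Set I} {n : ℕ} {w : M.W} {w' : N.W}
    (h : M.tp J (n + 1) w = N.tp J (n + 1) w') {s : Set M.W} (hs : s ∈ M.Sig w) :
    ∃ s' ∈ N.Sig w', M.tp J n '' s = N.tp J n '' s' := by
  have h₂ : {X | ∃ s ∈ M.Sig w, X = M.tp J n '' s} = {X | ∃ s ∈ N.Sig w', X = N.tp J n '' s} :=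
    congrArg Prod.snd h
  have : M.tp J n '' s ∈ {X | ∃ s ∈ M.Sig w, X = M.tp J n '' s} := ⟨s, hs, rfl⟩
  rw [h₂] at this
  exact this

end Model

/-- A property of world-pointed inquisitive models is definable by truth of a formula. -/
def TruthDefinable (A : (M : Model.{u, v} I) → M.W → Prop) : Prop :=
  ∃ φ : Form I, ∀ M w, M.Truth w φ ↔ A M w

namespace TruthDefinable

theorem not {A : (M : Model.{u, v} I) → M.W → Prop} (h : TruthDefinable A) :
    TruthDefinable fun M w => ¬ A M w := by
  obtain ⟨φ, hφ⟩ := h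
  exact ⟨φ.neg, fun M w => by rw [Form.truth_neg, hφ]⟩

theorem and {A B : (M : Model.{u, v} I) → M.W → Prop} (hA : TruthDefinable A)
    (hB : TruthDefinable B) : TruthDefinable fun M w => A M w ∧ B M w := by
  obtain ⟨φ, hφ⟩ := hA
  obtain ⟨ψ, hψ⟩ := hB
  exact ⟨φ.and ψ, fun M w => and_congr (hφ M w) (hψ M w)⟩

theorem iff_const {A : (M : Model.{u, v} I) → M.W → Prop} (h : TruthDefinable A) (c : Prop) :
    TruthDefinable fun M w => (A M w ↔ c) := by
  by_cases hc : c
  · simpa [hc] using h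
  · simpa [hc] using h.not

theorem forall_finite {ι : Type*} [Finite ι] {A : ι → (M : Model.{u, v} I) → M.W → Prop}
    (h : ∀ i, TruthDefinable (A i)) : TruthDefinable fun M w => ∀ i, A i M w := by
  choose φ hφ using h
  have := Fintype.ofFinite ι
  refine ⟨Form.conj ((Finset.univ : Finset ι).toList.map φ), fun M w => ?_⟩
  rw [Model.Truth, Form.supports_conj]
  simp only [List.mem_map, Finset.mem_toList, Finset.mem_univ, true_and, forall_exists_index,
    forall_apply_eq_imp_iff]
  exact forall_congr' fun i => hφ i M w

theorem congr {A B : (M : Model.{u, v} I) → M.W → Prop} (hA : TruthDefinable A)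
    (h : ∀ M w, A M w ↔ B M w) : TruthDefinable B :=
  hA.imp fun _ hφ M w => (hφ M w).trans (h M w)

theorem atomsAt_eq {J : Set I} (hJ : J.Finite) (a : Set J) :
    TruthDefinable fun (M : Model.{u, v} I) w => M.atomsAt J w = a := by
  have := hJ.to_subtype
  have hp : ∀ p : I, TruthDefinable fun (M : Model.{u, v} I) w => w ∈ M.V p := fun p =>
    ⟨.atom p, fun M w => by simp [Model.Truth, Model.Supports]⟩
  refine (forall_finite fun p : J => iff_const (hp p) (p ∈ a)).congr fun M w => ?_
  rw [Set.ext_iff]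
  exact Iff.rfl

/-- For nonempty `X`, the formula `¬⊞⩒_{τ ∈ X} ¬χ_τ`, with `⩒` the inquisitive disjunction, says
that some state of `Sig w` realises every type in `X`. Downward closure of `Sig w` then allows the
worlds of other types to be discarded. -/
theorem exists_mem_Sig_image_eq {J : Set I} {n : ℕ} (hJ : J.Finite)
    (h : ∀ τ : Ty J n, TruthDefinable fun (M : Model.{u, v} I) w => M.tp J n w = τ)
    (X : Set (Ty J n)) :
    TruthDefinable fun (M : Model.{u, v} I) w => ∃ s ∈ M.Sig w, X = M.tp J n '' s := by
  rcases X.eq_empty_or_nonempty with rfl | hX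
  -- For `X = ∅` the general formula would demand a nonempty state, whereas the empty one always
  -- suffices.
  · refine ⟨Form.neg .bot, fun M w => iff_of_true ?_ ⟨∅, M.empty_mem_Sig w, by simp⟩⟩
    exact fun t _ h => h
  · choose χ hχ using h
    have := Ty.finite hJ n
    have := Fintype.ofFinite X
    refine ⟨(Form.disj ((Finset.univ : Finset X).toList.map fun τ => (χ τ).neg)).wbox.neg,
      fun M w => ?_⟩
    have hw : M.Truth w (Form.disj
        ((Finset.univ : Finset X).toList.map fun τ => (χ τ).neg)).wbox ↔
        ∀ s ∈ M.Sig w, s = ∅ ∨ ∃ τ ∈ X, ∀ x ∈ s, M.tp J n x ≠ τ := by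
      simp [Form.truth_wbox, Form.supports_disj, Form.supports_neg, hχ]
    rw [Form.truth_neg, hw]
    push Not
    constructor
    · rintro ⟨s, hs, -, h⟩
      refine ⟨s ∩ M.tp J n ⁻¹' X, M.sig_down w s _ hs Set.inter_subset_left, ?_⟩
      ext τ
      constructor
      · intro hτ
        obtain ⟨x, hx, rfl⟩ := h τ hτ
        exact ⟨x, ⟨hx, hτ⟩, rfl⟩
      · rintro ⟨x, ⟨-, hx⟩, rfl⟩
        exact hx
    · rintro ⟨s, hs, rfl⟩
      exact ⟨s, hs, Set.image_nonempty.1 hX, fun τ hτ => hτ⟩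

/-- A type of level `n + 1` records the true atoms and, for each of the finitely many sets `X` of
types of level `n`, whether some available state realises exactly `X`. -/
theorem tp_eq {J : Set I} (hJ : J.Finite) (n : ℕ) (τ : Ty J n) :
    TruthDefinable fun (M : Model.{u, v} I) w => M.tp J n w = τ := by
  induction n with
  | zero => exact atomsAt_eq hJ τ
  | succ n ih =>
    have := Ty.finite hJ n
    obtain ⟨a, F⟩ : Set J × Set (Set (Ty J n)) := τ
    refine ((atomsAt_eq hJ a).and (forall_finite fun X =>
      iff_const (exists_mem_Sig_image_eq hJ ih X) (X ∈ F))).congr fun M w => ?_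
    refine Iff.trans ?_ (Prod.mk_inj (a₁ := M.atomsAt J w)
      (b₁ := {X | ∃ s ∈ M.Sig w, X = M.tp J n '' s})).symm
    rw [Set.ext_iff (a := {X | ∃ s ∈ M.Sig w, X = M.tp J n '' s})]
    exact Iff.rfl

end TruthDefinable

/-- Downward closed families of sets of types are definable by support. -/
theorem exists_form_supports_iff_image_tp_subset {J : Set I} (hJ : J.Finite) (n : ℕ)
    (F : Set (Set (Ty J n))) :
    ∃ φ : Form I, ∀ (M : Model.{u, v} I) (s : Set M.W),
      M.Supports s φ ↔ s = ∅ ∨ ∃ X ∈ F, M.tp J n '' s ⊆ X := by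
  have := Ty.finite hJ n
  have := Fintype.ofFinite F
  have hX : ∀ X : F, ∃ φ : Form I, ∀ (M : Model.{u, v} I) (s : Set M.W),
      M.Supports s φ ↔ M.tp J n '' s ⊆ X := by
    intro X
    obtain ⟨φ, hφ⟩ := TruthDefinable.forall_finite (ι := ↥((X : Set (Ty J n))ᶜ))
      fun τ => (TruthDefinable.tp_eq.{u, v} hJ n τ).not
    -- `φ` is true at the worlds whose type lies in `X`; double negation makes support equivalent to
    -- truth at every world of the state.
    refine ⟨φ.neg.neg, fun M s => ?_⟩
    rw [Form.supports_neg_neg, Set.image_subset_iff]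
    refine forall₂_congr fun w _ => (hφ M w).trans ?_
    constructor
    · intro h
      by_contra hw
      exact h ⟨_, hw⟩ rfl
    · rintro h ⟨τ, hτ⟩ rfl
      exact hτ h
  choose φ hφ using hX
  refine ⟨Form.disj ((Finset.univ : Finset F).toList.map φ), fun M s => ?_⟩
  rw [Form.supports_disj]
  simp [hφ]

/-! ### Translation into first-order logic -/

namespace FO

/-- Renaming of free variables. -/
def rename : {m n m' n' : ℕ} → FO I m n → (Fin m → Fin m') → (Fin n → Fin n') → FO I m' n'
  | _, _, _, _, .pred i x, f, _ => .pred i (f x)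
  | _, _, _, _, .relE x y, f, g => .relE (f x) (g y)
  | _, _, _, _, .relEps x y, f, g => .relEps (f x) (g y)
  | _, _, _, _, .eqW x y, f, _ => .eqW (f x) (f y)
  | _, _, _, _, .eqS x y, _, g => .eqS (g x) (g y)
  | _, _, _, _, .falsum, _, _ => .falsum
  | _, _, _, _, .imp φ ψ, f, g => .imp (φ.rename f g) (ψ.rename f g)
  | _, _, _, _, .allW φ, f, g =>
    .allW (φ.rename (Fin.snoc (fun x => (f x).castSucc) (Fin.last _)) g)
  | _, _, _, _, .allS φ, f, g =>
    .allS (φ.rename f (Fin.snoc (fun x => (g x).castSucc) (Fin.last _)))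

theorem snoc_comp_snoc {α : Type*} {m m' : ℕ} (a : Fin m' → α) (w : α) (f : Fin m → Fin m') :
    (fun x => (Fin.snoc a w : Fin (m' + 1) → α)
      ((Fin.snoc (fun x => (f x).castSucc) (Fin.last m') : Fin (m + 1) → Fin (m' + 1)) x)) =
      Fin.snoc (fun x => a (f x)) w := by
  funext x
  refine Fin.lastCases ?_ (fun x => ?_) x <;> simp

theorem sat_rename (M : RelModel.{u, v} I) {m n m' n' : ℕ} (φ : FO I m n)
    (f : Fin m → Fin m') (g : Fin n → Fin n') (a : Fin m' → M.W) (b : Fin n' → M.S) :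
    (φ.rename f g).Sat M a b ↔ φ.Sat M (fun x => a (f x)) (fun x => b (g x)) := by
  induction φ generalizing m' n' with
  | pred i x => exact Iff.rfl
  | relE x y => exact Iff.rfl
  | relEps x y => exact Iff.rfl
  | eqW x y => exact Iff.rfl
  | eqS x y => exact Iff.rfl
  | falsum => exact Iff.rfl
  | imp φ ψ h₁ h₂ => exact imp_congr (h₁ f g a b) (h₂ f g a b)
  | allW φ ih =>
    refine forall_congr' fun w => ?_
    rw [ih, snoc_comp_snoc]
  | allS φ ih =>
    refine forall_congr' fun w => ?_
    rw [ih, snoc_comp_snoc]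

/-- The instance `α(x)` of a formula with a single free world variable. -/
def inst {m n : ℕ} (α : FO I 1 0) (x : Fin m) : FO I m n := α.rename (fun _ => x) Fin.elim0

theorem sat_inst (M : RelModel.{u, v} I) {m n : ℕ} (α : FO I 1 0) (x : Fin m)
    (a : Fin m → M.W) (b : Fin n → M.S) : (α.inst x).Sat M a b ↔ α.Sat M ![a x] ![] := by
  rw [inst, sat_rename]
  congr! 1
  funext i
  fin_cases i
  rfl

/-- Negation. -/
def neg {m n : ℕ} (φ : FO I m n) : FO I m n := .imp φ .falsum

/-- Conjunction. -/
def and {m n : ℕ} (φ ψ : FO I m n) : FO I m n := (φ.imp ψ.neg).neg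

/-- Disjunction of a list of formulae. -/
def disj {m n : ℕ} : List (FO I m n) → FO I m n
  | [] => .falsum
  | φ :: l => φ.neg.imp (disj l)

theorem sat_and (M : RelModel.{u, v} I) {m n : ℕ} (φ ψ : FO I m n) (a : Fin m → M.W)
    (b : Fin n → M.S) : (φ.and ψ).Sat M a b ↔ φ.Sat M a b ∧ ψ.Sat M a b := by
  simp only [and, neg, Sat]
  tauto

theorem sat_disj (M : RelModel.{u, v} I) {m n : ℕ} (l : List (FO I m n)) (a : Fin m → M.W)
    (b : Fin n → M.S) : (disj l).Sat M a b ↔ ∃ φ ∈ l, φ.Sat M a b := by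
  induction l with
  | nil => simp [disj, Sat]
  | cons φ l ih =>
    simp only [disj, neg, Sat, ih, List.exists_mem_cons_iff]
    tauto

/-- `α` holds at all worlds of the state `y`. -/
def onState {m n : ℕ} (α : FO I 1 0) (y : Fin n) : FO I m n :=
  .allW (.imp (.relEps (Fin.last m) y) (α.inst (Fin.last m)))

theorem sat_onState (M : RelModel.{u, v} I) {m n : ℕ} (α : FO I 1 0) (y : Fin n)
    (a : Fin m → M.W) (b : Fin n → M.S) :
    (α.onState y).Sat M a b ↔ ∀ w ∈ M.ext (b y), α.Sat M ![w] ![] := by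
  simp only [onState, Sat, sat_inst, Fin.snoc_last]
  exact Iff.rfl

/-- Formulae expressing that some `α ∈ L` holds throughout each state in `E[w]`. -/
def wbox (L : List (FO I 1 0)) : FO I 1 0 :=
  .allS (.imp (.relE 0 0) (disj (L.map fun α => α.onState 0)))

theorem sat_wbox (M : RelModel.{u, v} I) (L : List (FO I 1 0)) (w : M.W) :
    (wbox L).Sat M ![w] ![] ↔
      ∀ s, M.E w s → ∃ α ∈ L, ∀ v ∈ M.ext s, α.Sat M ![v] ![] := by
  simp only [wbox, Sat, sat_disj, List.mem_map, exists_exists_and_eq_and, sat_onState]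
  exact Iff.rfl

/-- Formulae expressing that some `α ∈ L` holds throughout `R[w]`. -/
def box (L : List (FO I 1 0)) : FO I 1 0 := disj (L.map fun α => wbox [α])

theorem sat_box (M : RelModel.{u, v} I) (L : List (FO I 1 0)) (w : M.W) :
    (box L).Sat M ![w] ![] ↔ ∃ α ∈ L, ∀ v ∈ M.R w, α.Sat M ![v] ![] := by
  simp only [box, sat_disj, List.mem_map, exists_exists_and_eq_and, sat_wbox, List.mem_singleton,
    exists_eq_left]
  refine exists_congr fun α => and_congr_right fun _ => ?_
  exact ⟨fun h x ⟨t, ht, hx⟩ => h t ht x hx, fun h t ht x hx => h x ⟨t, ht, hx⟩⟩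

/-- The formulae `⋀ (α → f α)` for all choice functions `f` from `L` to `K`. -/
def choices (K : List (FO I 1 0)) : List (FO I 1 0) → List (FO I 1 0)
  | [] => [.imp .falsum .falsum]
  | α :: L => (List.product K (choices K L)).map fun p => (α.imp p.1).and p.2

/-- This is distributivity of conjunction over disjunction: choosing some `β ∈ K` for each `α ∈ L`
amounts to choosing one function from `L` to `K`. -/
theorem exists_mem_choices (M : RelModel.{u, v} I) (K L : List (FO I 1 0)) (s : Set M.W) :
    (∃ γ ∈ choices K L, ∀ w ∈ s, γ.Sat M ![w] ![]) ↔
      ∀ α ∈ L, ∃ β ∈ K, ∀ w ∈ s, α.Sat M ![w] ![] → β.Sat M ![w] ![] := by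
  induction L with
  | nil => simp [choices, Sat]
  | cons α L ih =>
    rw [List.forall_mem_cons, ← ih]
    constructor
    · rintro ⟨γ, hγ, h⟩
      obtain ⟨⟨β, δ⟩, hp, rfl⟩ := List.mem_map.1 hγ
      obtain ⟨hβ, hδ⟩ := List.mem_product.1 hp
      exact ⟨⟨β, hβ, fun w hw => ((sat_and M _ _ _ _).1 (h w hw)).1⟩,
        δ, hδ, fun w hw => ((sat_and M _ _ _ _).1 (h w hw)).2⟩
    · rintro ⟨⟨β, hβ, h₁⟩, δ, hδ, h₂⟩
      exact ⟨(α.imp β).and δ, List.mem_map.2 ⟨(β, δ), List.mem_product.2 ⟨hβ, hδ⟩, rfl⟩,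
        fun w hw => (sat_and M _ _ _ _).2 ⟨h₁ w hw, h₂ w hw⟩⟩

end FO

theorem RelModel.sigma_star (M : RelModel.{u, v} I) (w : M.W) : M.star.sigma w = M.R w := by
  ext x
  constructor
  · rintro ⟨_, ⟨s, hs, rfl⟩, hx⟩
    exact ⟨s, hs, hx⟩
  · rintro ⟨s, hs, hx⟩
    exact ⟨M.ext s, ⟨s, hs, rfl⟩, hx⟩

/-- Every formula is an inquisitive disjunction of first-order properties of worlds. -/
theorem exists_list_supports_iff (φ : Form I) :
    ∃ L : List (FO I 1 0), ∀ (M : RelModel.{u, v} I) (s : Set M.W),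
      M.star.Supports s φ ↔ ∃ α ∈ L, ∀ w ∈ s, α.Sat M ![w] ![] := by
  induction φ with
  | atom p =>
    refine ⟨[.pred p 0], fun M s => ?_⟩
    simp only [List.mem_singleton, exists_eq_left]
    exact Iff.rfl
  | bot =>
    refine ⟨[.falsum], fun M s => ?_⟩
    simp only [List.mem_singleton, exists_eq_left]
    exact Set.eq_empty_iff_forall_notMem
  | and φ ψ h₁ h₂ =>
    obtain ⟨L, hL⟩ := h₁
    obtain ⟨K, hK⟩ := h₂
    refine ⟨(L.product K).map fun p => p.1.and p.2, fun M s => ?_⟩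
    refine (and_congr (hL M s) (hK M s)).trans ?_
    constructor
    · rintro ⟨⟨α, hα, h₁⟩, β, hβ, h₂⟩
      exact ⟨α.and β, List.mem_map.2 ⟨(α, β), List.mem_product.2 ⟨hα, hβ⟩, rfl⟩,
        fun w hw => (FO.sat_and M _ _ _ _).2 ⟨h₁ w hw, h₂ w hw⟩⟩
    · rintro ⟨γ, hγ, h⟩
      obtain ⟨⟨α, β⟩, hp, rfl⟩ := List.mem_map.1 hγ
      obtain ⟨hα, hβ⟩ := List.mem_product.1 hp
      exact ⟨⟨α, hα, fun w hw => ((FO.sat_and M _ _ _ _).1 (h w hw)).1⟩,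
        β, hβ, fun w hw => ((FO.sat_and M _ _ _ _).1 (h w hw)).2⟩
  | imp φ ψ h₁ h₂ =>
    obtain ⟨L, hL⟩ := h₁
    obtain ⟨K, hK⟩ := h₂
    refine ⟨FO.choices K L, fun M s => ?_⟩
    rw [FO.exists_mem_choices]
    constructor
    · intro h α hα
      -- The worlds of `s` satisfying `α` form the largest substate at which `α` holds throughout,
      -- so by persistence it alone needs testing.
      have := h {w | w ∈ s ∧ α.Sat M ![w] ![]} (fun w hw => hw.1)
        ((hL M _).2 ⟨α, hα, fun w hw => hw.2⟩)
      obtain ⟨β, hβ, h⟩ := (hK M _).1 this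
      exact ⟨β, hβ, fun w hw h' => h w ⟨hw, h'⟩⟩
    · intro h t ht hφ
      obtain ⟨α, hα, h'⟩ := (hL M t).1 hφ
      obtain ⟨β, hβ, h⟩ := h α hα
      exact (hK M t).2 ⟨β, hβ, fun w hw => h w (ht hw) (h' w hw)⟩
  | idisj φ ψ h₁ h₂ =>
    obtain ⟨L, hL⟩ := h₁
    obtain ⟨K, hK⟩ := h₂
    refine ⟨L ++ K, fun M s => (or_congr (hL M s) (hK M s)).trans ?_⟩
    simp only [List.mem_append, or_and_right, exists_or]
  | box φ ih =>
    obtain ⟨L, hL⟩ := ih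
    -- Modal formulae are truth-conditional, so a single disjunct is enough.
    refine ⟨[.box L], fun M s => ?_⟩
    simp only [List.mem_singleton, exists_eq_left]
    refine forall₂_congr fun w _ => Iff.trans ?_ (FO.sat_box M L w).symm
    exact (iff_of_eq (congrArg (M.star.Supports · φ) (M.sigma_star w))).trans (hL M (M.R w))
  | wbox φ ih =>
    obtain ⟨L, hL⟩ := ih
    refine ⟨[.wbox L], fun M s => ?_⟩
    simp only [List.mem_singleton, exists_eq_left]
    refine forall₂_congr fun w _ => Iff.trans ?_ (FO.sat_wbox M L w).symm
    constructor
    · exact fun h t ht => (hL M _).1 (h _ ⟨t, ht, rfl⟩)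
    · rintro h _ ⟨t, ht, rfl⟩
      exact (hL M _).2 (h t ht)

theorem WorldProperty.InqDefinable.foDefinable {C : ModelClass} {Q : WorldProperty.{u, v} I}
    (h : Q.InqDefinable C) : Q.FODefinable C := by
  obtain ⟨φ, hφ⟩ := h
  obtain ⟨L, hL⟩ := exists_list_supports_iff.{u, v} φ
  refine ⟨.disj L, fun M hM w => ?_⟩
  rw [hφ M hM w, FO.sat_disj]
  exact (hL M {w}).trans (by simp)

theorem StateProperty.InqDefinable.foDefinable {C : ModelClass} {Q : StateProperty.{u, v} I}
    (h : Q.InqDefinable C) : Q.FODefinable C := by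
  obtain ⟨φ, hφ⟩ := h
  obtain ⟨L, hL⟩ := exists_list_supports_iff.{u, v} φ
  refine ⟨.disj (L.map fun α => α.onState 0), fun M hM s => ?_⟩
  rw [hφ M hM s, FO.sat_disj, hL]
  simp [FO.sat_onState]

/-! ### Relational models over inquisitive models -/

theorem ModelClass.Contains.of_imp {C : ModelClass} {M N : RelModel.{u, v} I}
    (h : C.Contains M) (hfin : M.IsFinite → N.IsFinite)
    (hfull : M.LocallyFull → N.LocallyFull) : C.Contains N := by
  cases C with
  | all => trivial
  | finite => exact hfin h
  | locallyFull => exact hfull h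
  | finiteLocallyFull => exact ⟨hfin h.1, hfull h.2⟩

namespace RelModel

/-- The relational model over an inquisitive model with a given family of states. -/
def ofModel (M : Model.{u, v} I) (hM : Nonempty M.W) (𝒮 : Set (Set M.W))
    (h𝒮 : ∀ s ∈ 𝒮, ∀ t ⊆ s, t ∈ 𝒮) (hSig : ∀ w, M.Sig w ⊆ 𝒮) : RelModel.{u, v} I where
  W := M.W
  S := 𝒮
  E w s := s.1 ∈ M.Sig w
  eps w s := w ∈ s.1
  P p w := w ∈ M.V p
  nonempty_W := hM
  nonempty_S := by
    obtain ⟨w⟩ := hM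
    exact ⟨⟨∅, hSig w (M.empty_mem_Sig w)⟩⟩
  extensionality s s' h := Subtype.ext h
  local_powerset s t h := ⟨⟨t, h𝒮 s.1 s.2 t h⟩, rfl⟩
  nonemptiness w := ⟨⟨∅, hSig w (M.empty_mem_Sig w)⟩, M.empty_mem_Sig w⟩
  downward_closure w s s' h hs := M.sig_down w s.1 s'.1 h hs

variable {M : Model.{u, v} I} {hM : Nonempty M.W} {𝒮 : Set (Set M.W)}
  {h𝒮 : ∀ s ∈ 𝒮, ∀ t ⊆ s, t ∈ 𝒮} {hSig : ∀ w, M.Sig w ⊆ 𝒮}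

theorem mem_Sig_star_ofModel {w : M.W} {t : Set M.W} :
    t ∈ (ofModel M hM 𝒮 h𝒮 hSig).star.Sig w ↔ t ∈ M.Sig w := by
  constructor
  · rintro ⟨s, hs, rfl⟩
    exact hs
  · exact fun ht => ⟨⟨t, hSig w ht⟩, ht, rfl⟩

theorem _root_.Inq.Model.WorldBisim.ofModel {K : Model.{u, v} I} {x : K.W} {w : M.W}
    (h : Model.WorldBisim K x M w) :
    Model.WorldBisim K x (ofModel M hM 𝒮 h𝒮 hSig).star w := by
  obtain ⟨ZW, ZS, h, hw⟩ := h
  exact ⟨ZW, ZS,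
    { atoms := h.atoms
      state_forth := h.state_forth
      state_back := h.state_back
      world_forth := fun y z hyz s hs => (h.world_forth y z hyz s hs).imp fun _ h =>
        ⟨mem_Sig_star_ofModel.2 h.1, h.2⟩
      world_back := fun y z hyz s hs => h.world_back y z hyz s (mem_Sig_star_ofModel.1 hs) }, hw⟩

theorem _root_.Inq.Model.StateBisim.ofModel {K : Model.{u, v} I} {t : Set K.W} {s : Set M.W}
    (h : Model.StateBisim K t M s) :
    Model.StateBisim K t (ofModel M hM 𝒮 h𝒮 hSig).star s :=
  ⟨fun x hx => (h.1 x hx).imp fun _ h => ⟨h.1, h.2.ofModel⟩,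
    fun x hx => (h.2 x hx).imp fun _ h => ⟨h.1, h.2.ofModel⟩⟩

theorem isFinite_ofModel [Finite M.W] : (ofModel M hM 𝒮 h𝒮 hSig).IsFinite :=
  ⟨inferInstanceAs (Finite M.W), inferInstanceAs (Finite 𝒮)⟩

theorem locallyFull_ofModel (h : ∀ w, ∀ t ⊆ M.sigma w, t ∈ 𝒮) :
    (ofModel M hM 𝒮 h𝒮 hSig).LocallyFull := by
  intro w t ht
  refine ⟨⟨t, h w t fun x hx => ?_⟩, rfl⟩
  obtain ⟨s, hs, hx⟩ := ht hx
  exact ⟨s.1, hs, hx⟩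

/-- The extension of a relational model by the state `{w}`. -/
def addSingleton (M : RelModel.{u, v} I) (w : M.W) : RelModel.{u, v} I :=
  ofModel M.star M.nonempty_W {t | (∃ s, M.ext s = t) ∨ t = {w}}
    (by
      rintro s (⟨s, rfl⟩ | rfl) t ht
      · exact Or.inl (M.local_powerset s t ht)
      · rcases Set.subset_singleton_iff_eq.1 ht with rfl | rfl
        · obtain ⟨s⟩ := M.nonempty_S
          exact Or.inl (M.local_powerset s ∅ (Set.empty_subset _))
        · exact Or.inr rfl)
    (by
      rintro x _ ⟨s, -, rfl⟩
      exact Or.inl ⟨s, rfl⟩)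

/-- The sets `R w` do not change, so local fullness demands no further states; finiteness of the
world sort bounds any family of sets of worlds. -/
theorem contains_addSingleton {C : ModelClass} {M : RelModel.{u, v} I} (h : C.Contains M)
    (w : M.W) : C.Contains (M.addSingleton w) := by
  refine h.of_imp (fun h => ?_) fun h => ?_
  · have : Finite M.star.W := h.1
    exact isFinite_ofModel
  · refine locallyFull_ofModel fun x t ht => Or.inl ?_
    exact h x t (ht.trans (M.sigma_star x).subset)

/-- The restriction of the valuation to the atoms in `J`. -/
def restrict (M : RelModel.{u, v} I) (J : Set I) : RelModel.{u, v} I :=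
  { M with P := fun p w => p ∈ J ∧ M.P p w }

theorem contains_restrict {C : ModelClass} {M : RelModel.{u, v} I} (h : C.Contains M)
    (J : Set I) : C.Contains (M.restrict J) :=
  h.of_imp id id

end RelModel

/-! ### Atoms and quantifier rank of first-order formulae -/

namespace FO

/-- The atoms occurring in a formula. -/
def atoms : {m n : ℕ} → FO I m n → Set I
  | _, _, .pred i _ => {i}
  | _, _, .relE _ _ => ∅
  | _, _, .relEps _ _ => ∅
  | _, _, .eqW _ _ => ∅
  | _, _, .eqS _ _ => ∅
  | _, _, .falsum => ∅
  | _, _, .imp φ ψ => φ.atoms ∪ ψ.atoms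
  | _, _, .allW φ => φ.atoms
  | _, _, .allS φ => φ.atoms

theorem finite_atoms {m n : ℕ} (φ : FO I m n) : φ.atoms.Finite := by
  induction φ with
  | pred i x => exact Set.finite_singleton i
  | imp φ ψ h₁ h₂ => exact h₁.union h₂
  | allW φ ih => exact ih
  | allS φ ih => exact ih
  | _ => exact Set.finite_empty

theorem sat_restrict (M : RelModel.{u, v} I) {J : Set I} {m n : ℕ} (φ : FO I m n)
    (hφ : φ.atoms ⊆ J) (a : Fin m → M.W) (b : Fin n → M.S) :
    φ.Sat (M.restrict J) a b ↔ φ.Sat M a b := by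
  induction φ with
  | pred i x => exact and_iff_right (hφ rfl)
  | relE x y => exact Iff.rfl
  | relEps x y => exact Iff.rfl
  | eqW x y => exact Iff.rfl
  | eqS x y => exact Iff.rfl
  | falsum => exact Iff.rfl
  | imp φ ψ h₁ h₂ =>
    exact imp_congr (h₁ (Set.subset_union_left.trans hφ) a b)
      (h₂ (Set.subset_union_right.trans hφ) a b)
  | allW φ ih => exact forall_congr' fun w => ih hφ _ b
  | allS φ ih => exact forall_congr' fun s => ih hφ a _

/-- Quantifier rank. -/
def rank : {m n : ℕ} → FO I m n → ℕ
  | _, _, .imp φ ψ => max φ.rank ψ.rank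
  | _, _, .allW φ => φ.rank + 1
  | _, _, .allS φ => φ.rank + 1
  | _, _, _ => 0

end FO

/-! ### Layered models -/

/-- Copies of a model: they are indexed by a natural number and a flag. -/
abbrev Copy (N : ℕ) : Type := Fin (N + 1) × Bool

/-- The layer following `i`; the last layer is followed by itself. -/
def nextLayer {n : ℕ} (i : Fin (n + 1)) : Fin (n + 1) := ⟨min (i + 1) n, by omega⟩

/-- The set `t` in layer `i` of the copy `c`. -/
def cell {N n : ℕ} {X : Type u} (c : Copy N) (i : Fin (n + 1)) (t : Set X) :
    Set (Copy N × Fin (n + 1) × X) := {x | x.1 = c ∧ x.2.1 = i ∧ x.2.2 ∈ t}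

section cell

variable {N n : ℕ} {X : Type u} {c c' : Copy N} {i i' : Fin (n + 1)} {t t' : Set X}

theorem mk_mem_cell {x : X} : (c, i, x) ∈ cell c' i' t ↔ c = c' ∧ i = i' ∧ x ∈ t := Iff.rfl

theorem cell_empty : cell c i (∅ : Set X) = ∅ :=
  Set.eq_empty_of_forall_notMem fun _ h => h.2.2

theorem exists_eq_cell_of_subset {r : Set (Copy N × Fin (n + 1) × X)} (h : r ⊆ cell c i t) :
    ∃ t' ⊆ t, r = cell c i t' := by
  refine ⟨{x | (c, i, x) ∈ r}, fun x hx => (h hx).2.2, ?_⟩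
  ext ⟨c', i', x⟩
  constructor
  · intro hx
    obtain ⟨rfl, rfl, -⟩ := h hx
    exact ⟨rfl, rfl, hx⟩
  · rintro ⟨rfl, rfl, hx⟩
    exact hx

/-- Nonempty cells determine their copy and layer, but extensionality forces all copies and layers
to share one empty state. -/
theorem cell_eq_cell_iff :
    cell c i t = cell c' i' t' ↔ (t = ∅ ∧ t' = ∅) ∨ (c = c' ∧ i = i' ∧ t = t') := by
  constructor
  · intro h
    rcases t.eq_empty_or_nonempty with rfl | ⟨x, hx⟩
    · refine Or.inl ⟨rfl, Set.eq_empty_of_forall_notMem fun x hx => ?_⟩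
      have : (c', i', x) ∈ cell c i ∅ := h ▸ ⟨rfl, rfl, hx⟩
      exact this.2.2
    · obtain ⟨rfl, rfl, -⟩ : (c, i, x) ∈ cell c' i' t' := h ▸ ⟨rfl, rfl, hx⟩
      refine Or.inr ⟨rfl, rfl, ?_⟩
      ext y
      have := Set.ext_iff.1 h (c, i, y)
      simpa [mk_mem_cell] using this
  · rintro (⟨rfl, rfl⟩ | ⟨rfl, rfl, rfl⟩)
    · rw [cell_empty, cell_empty]
    · rfl

end cell

namespace Model

/-- Several copies of layered versions of `M`. The inquisitive state of a world in layer `i` lives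
in the next layer of the same copy, but in copies with flag `false` it is trivial in the last
layer. The valuation is restricted to the atoms in `J`. -/
def layered (M : Model.{u, v} I) (J : Set I) (N n : ℕ) : Model.{u, v} I where
  W := Copy N × Fin (n + 1) × M.W
  Sig x := {t | ∃ t₀ ∈ M.Sig x.2.2, (t₀ = ∅ ∨ (x.2.1 : ℕ) < n ∨ x.1.2 = true) ∧
    t = cell x.1 (nextLayer x.2.1) t₀}
  sig_nonempty x := ⟨_, ∅, M.empty_mem_Sig x.2.2, Or.inl rfl, rfl⟩
  sig_down x := by
    rintro _ t ⟨t₀, h₀, h, rfl⟩ ht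
    obtain ⟨t', ht', rfl⟩ := exists_eq_cell_of_subset ht
    refine ⟨t', M.sig_down _ _ _ h₀ ht', h.imp_left ?_, rfl⟩
    rintro rfl
    exact Set.subset_empty_iff.1 ht'
  V p := {x | p ∈ J ∧ x.2.2 ∈ M.V p}

end Model

namespace RelModel

theorem exists_ext_eq_of_subset (M : RelModel.{u, v} I) {s : M.S} {t : Set M.W}
    (h : t ⊆ M.ext s) : ∃ s', M.ext s' = t := M.local_powerset s t h

/-- The layered version of a relational model. -/
def layered (M : RelModel.{u, v} I) (J : Set I) (N n : ℕ) : RelModel.{u, v} I :=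
  ofModel (M.star.layered J N n) ⟨(((0 : Fin (N + 1)), true), 0, M.nonempty_W.some)⟩
    {t | ∃ c i s, t = cell c i (M.ext s)}
    (by
      rintro _ ⟨c, i, s, rfl⟩ t ht
      obtain ⟨t', ht', rfl⟩ := exists_eq_cell_of_subset ht
      obtain ⟨s', rfl⟩ := M.exists_ext_eq_of_subset ht'
      exact ⟨c, i, s', rfl⟩)
    (by
      rintro x _ ⟨_, ⟨s, -, rfl⟩, -, rfl⟩
      exact ⟨_, _, s, rfl⟩)

/-- The copy of the world `w` in layer `i` of the copy `c`. -/
def layeredWorld (M : RelModel.{u, v} I) (J : Set I) {N n : ℕ} (c : Copy N) (i : Fin (n + 1))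
    (w : M.W) : (M.layered J N n).W := (c, i, w)

/-- The copy of the state `s` in layer `i` of the copy `c`. -/
def layeredState (M : RelModel.{u, v} I) (J : Set I) {N n : ℕ} (c : Copy N) (i : Fin (n + 1))
    (s : M.S) : (M.layered J N n).S := ⟨cell c i (M.ext s), c, i, s, rfl⟩

/-- All worlds accessible from a given one lie in a single cell over the old `R`, so their subsets
are cells over states of `M`. -/
theorem contains_layered {C : ModelClass} {M : RelModel.{u, v} I} (h : C.Contains M)
    (J : Set I) (N n : ℕ) : C.Contains (M.layered J N n) := by
  refine h.of_imp (fun h => ?_) fun h => ?_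
  · have : Finite M.W := h.1
    have : Finite (M.star.layered J N n).W :=
      inferInstanceAs (Finite (Copy N × Fin (n + 1) × M.W))
    exact isFinite_ofModel
  · refine locallyFull_ofModel fun x t ht => ?_
    have : t ⊆ cell x.1 (nextLayer x.2.1) (M.R x.2.2) := by
      intro y hy
      obtain ⟨_, ⟨_, ⟨s, hs, rfl⟩, -, rfl⟩, hy⟩ := ht hy
      exact ⟨hy.1, hy.2.1, s, hs, hy.2.2⟩
    obtain ⟨t', ht', rfl⟩ := exists_eq_cell_of_subset this
    obtain ⟨s, rfl⟩ := h x.2.2 t' ht'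
    exact ⟨_, _, s, rfl⟩

variable (M : RelModel.{u, v} I) (J : Set I) {N n : ℕ}

theorem exists_eq_layeredWorld (w : (M.layered J N n).W) :
    ∃ c i w₀, w = M.layeredWorld J c i w₀ := ⟨w.1, w.2.1, w.2.2, rfl⟩

theorem layeredWorld_eq_iff {c c' : Copy N} {i i' : Fin (n + 1)} {w w' : M.W} :
    M.layeredWorld J c i w = M.layeredWorld J c' i' w' ↔ c = c' ∧ i = i' ∧ w = w' :=
  Prod.mk_inj.trans (and_congr_right fun _ => Prod.mk_inj)

theorem exists_eq_layeredState (s : (M.layered J N n).S) :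
    ∃ c i s₀, s = M.layeredState J c i s₀ := by
  obtain ⟨_, c, i, s₀, rfl⟩ := s
  exact ⟨c, i, s₀, rfl⟩

theorem layered_eps_iff {c c' : Copy N} {i i' : Fin (n + 1)} {w : M.W} {s : M.S} :
    (M.layered J N n).eps (M.layeredWorld J c i w) (M.layeredState J c' i' s) ↔
      c = c' ∧ i = i' ∧ M.eps w s := Iff.rfl

theorem layeredState_eq_iff {c c' : Copy N} {i i' : Fin (n + 1)} {s s' : M.S} :
    M.layeredState J c i s = M.layeredState J c' i' s' ↔
      (M.ext s = ∅ ∧ M.ext s' = ∅) ∨ (c = c' ∧ i = i' ∧ M.ext s = M.ext s') :=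
  Subtype.ext_iff.trans cell_eq_cell_iff

theorem layered_E_iff {c c' : Copy N} {i i' : Fin (n + 1)} {w : M.W} {s : M.S} :
    (M.layered J N n).E (M.layeredWorld J c i w) (M.layeredState J c' i' s) ↔
      M.ext s = ∅ ∨
        (c = c' ∧ nextLayer i = i' ∧ ((i : ℕ) < n ∨ c.2 = true) ∧ M.E w s) := by
  constructor
  · rintro ⟨_, ⟨s₀, hs₀, rfl⟩, h, heq⟩
    rcases cell_eq_cell_iff.1 heq with ⟨h, -⟩ | ⟨rfl, rfl, h'⟩
    · exact Or.inl h
    · obtain rfl := M.extensionality _ _ h'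
      exact h.imp_right fun h => ⟨rfl, rfl, h, hs₀⟩
  · rintro (h | ⟨rfl, rfl, h, hE⟩)
    · refine ⟨∅, M.star.empty_mem_Sig w, Or.inl rfl, ?_⟩
      exact cell_eq_cell_iff.2 (Or.inl ⟨h, rfl⟩)
    · exact ⟨M.ext s, ⟨s, hE, rfl⟩, Or.inr h, rfl⟩

end RelModel

/-! ### The Ehrenfeucht–Fraïssé game on layered models -/

/-- Pairs of copies, with the layers in which they are pebbled, such that the pebbles at
distance at most `d` from each other, or from the last layer `n`, match. -/
structure Matched {N : ℕ} (n d : ℕ) (L : List (Copy N × Copy N × ℕ)) : Prop where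
  eq_iff : ∀ p ∈ L, ∀ p' ∈ L, p.2.2 ≤ p'.2.2 + d → p'.2.2 ≤ p.2.2 + d →
    (p.1 = p'.1 ↔ p.2.1 = p'.2.1)
  flag : ∀ p ∈ L, n ≤ p.2.2 + d → p.1.2 = p.2.1.2

namespace Matched

variable {N n d d' : ℕ} {L : List (Copy N × Copy N × ℕ)}

theorem mono (h : Matched n d L) (hd : d' ≤ d) : Matched n d' L where
  eq_iff p hp p' hp' h₁ h₂ := h.eq_iff p hp p' hp' (by omega) (by omega)
  flag p hp h₁ := h.flag p hp (by omega)

theorem swap (h : Matched n d L) : Matched n d (L.map fun p => (p.2.1, p.1, p.2.2)) where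
  eq_iff := by
    simp only [List.forall_mem_map]
    exact fun p hp p' hp' h₁ h₂ => (h.eq_iff p hp p' hp' h₁ h₂).symm
  flag := by
    simp only [List.forall_mem_map]
    exact fun p hp h₁ => (h.flag p hp h₁).symm

/-- There are `N + 1` copies with each flag, more than the list can exhaust. -/
theorem exists_fresh_copy (l : List (Copy N)) (hl : l.length ≤ N) (v : Bool) :
    ∃ c ∉ l, c.2 = v := by
  by_contra! h
  have hsub : (Finset.univ : Finset (Fin (N + 1))).map ⟨fun j => (j, v), fun _ _ h => by
      simpa using h⟩ ⊆ l.toFinset := by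
    intro c hc
    obtain ⟨j, -, rfl⟩ := Finset.mem_map.1 hc
    by_contra hj
    exact h _ (fun hmem => hj (List.mem_toFinset.2 hmem)) rfl
  have := (Finset.card_le_card hsub).trans l.toFinset_card_le
  simp at this
  omega

/-- Duplicator's answer. If a pebble in the same copy is within distance `d`, its partner's copy is
used, and the triangle inequality turns conditions at distance `d` from the new pebble into
conditions at distance `2 * d` from the old one. Otherwise a fresh copy with the same flag works.
Halving the distance in each round accounts for the bound `2 ^ rank`. -/
theorem exists_cons (h : Matched n (2 * d) L) (hL : L.length ≤ N) (c : Copy N) (i : ℕ) :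
    ∃ c', Matched n d ((c, c', i) :: L) := by
  by_cases hc : ∃ p ∈ L, p.1 = c ∧ p.2.2 ≤ i + d ∧ i ≤ p.2.2 + d
  · obtain ⟨p, hp, rfl, h₁, h₂⟩ := hc
    refine ⟨p.2.1, ⟨?_, ?_⟩⟩
    · have key : ∀ p' ∈ L, i ≤ p'.2.2 + d → p'.2.2 ≤ i + d →
          (p.1 = p'.1 ↔ p.2.1 = p'.2.1) := fun p' hp' h₃ h₄ =>
        h.eq_iff p hp p' hp' (by omega) (by omega)
      simp only [List.forall_mem_cons]
      refine ⟨⟨fun _ _ => by simp, key⟩, fun p' hp' => ⟨fun h₃ h₄ => ?_, fun p'' hp'' h₃ h₄ => ?_⟩⟩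
      · rw [eq_comm, key p' hp' h₄ h₃, eq_comm]
      · exact h.eq_iff p' hp' p'' hp'' (by omega) (by omega)
    · simp only [List.forall_mem_cons]
      exact ⟨fun h₃ => h.flag p hp (by omega), fun p' hp' h₃ => h.flag p' hp' (by omega)⟩
  · obtain ⟨c', hc', hv⟩ := exists_fresh_copy (L.map fun p => p.2.1) (by simpa using hL) c.2
    simp only [List.mem_map, not_exists, not_and] at hc'
    refine ⟨c', ⟨?_, ?_⟩⟩
    · have key : ∀ p' ∈ L, i ≤ p'.2.2 + d → p'.2.2 ≤ i + d →
          (c = p'.1 ↔ c' = p'.2.1) := fun p' hp' h₃ h₄ =>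
        iff_of_false (fun h => hc ⟨p', hp', h.symm, h₄, h₃⟩) fun h => hc' p' hp' h.symm
      simp only [List.forall_mem_cons]
      refine ⟨⟨fun _ _ => by simp, key⟩, fun p' hp' => ⟨fun h₃ h₄ => ?_, fun p'' hp'' h₃ h₄ => ?_⟩⟩
      · rw [eq_comm, key p' hp' h₄ h₃, eq_comm]
      · exact h.eq_iff p' hp' p'' hp'' (by omega) (by omega)
    · simp only [List.forall_mem_cons]
      exact ⟨fun _ => hv.symm, fun p' hp' h₃ => h.flag p' hp' (by omega)⟩

theorem exists_cons' (h : Matched n (2 * d) L) (hL : L.length ≤ N) (c' : Copy N) (i : ℕ) :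
    ∃ c, Matched n d ((c, c', i) :: L) := by
  obtain ⟨c, hc⟩ := h.swap.exists_cons (by simpa using hL) c' i
  refine ⟨c, ?_⟩
  simpa [Function.comp_def] using hc.swap

end Matched

/-- The two assignments differ only in the copies. Atomic formulae relate layers at distance at most
`1` and see the flag only in the last layer, so matching at distance `2 ^ 0` decides them. The bound
on `N` leaves a spare copy for each remaining move. -/
theorem FO.sat_layered_iff (M : RelModel.{u, v} I) (J : Set I) {N n k l : ℕ} (φ : FO I k l)
    {L : List (Copy N × Copy N × ℕ)} (hL : Matched n (2 ^ φ.rank) L)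
    (hN : L.length + φ.rank ≤ N + 1)
    {a a' : Fin k → (M.layered J N n).W} {b b' : Fin l → (M.layered J N n).S}
    (ha : ∀ x, ∃ p ∈ L, ∃ (i : Fin (n + 1)) (w : M.W),
      (i : ℕ) = p.2.2 ∧ a x = M.layeredWorld J p.1 i w ∧
        a' x = M.layeredWorld J p.2.1 i w)
    (hb : ∀ y, ∃ p ∈ L, ∃ (i : Fin (n + 1)) (s : M.S), (i : ℕ) = p.2.2 ∧
      b y = M.layeredState J p.1 i s ∧ b' y = M.layeredState J p.2.1 i s) :
    φ.Sat (M.layered J N n) a b ↔ φ.Sat (M.layered J N n) a' b' := by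
  induction φ generalizing L with
  | pred p x =>
    obtain ⟨p, -, i, w, -, h, h'⟩ := ha x
    simp only [Sat, h, h']
    exact Iff.rfl
  | relE x y =>
    replace hL : Matched n 1 L := hL
    obtain ⟨p, hp, i, w, hi, h, h'⟩ := ha x
    obtain ⟨p₂, hp₂, i₂, s, hi₂, h₂, h₂'⟩ := hb y
    simp only [Sat, h, h', h₂, h₂', RelModel.layered_E_iff]
    refine or_congr_right ?_
    have hn := i.2
    rcases eq_or_ne (nextLayer i) i₂ with rfl | hne
    · have hnx : p₂.2.2 = min ((i : ℕ) + 1) n := hi₂.symm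
      have heq := hL.eq_iff p hp p₂ hp₂ (by omega) (by omega)
      refine and_congr heq (and_congr_right fun _ => and_congr_left fun _ => ?_)
      by_cases hi' : (i : ℕ) < n
      · simp [hi']
      -- Here `i` is the last layer, the only place where the flag affects `E`.
      · rw [hL.flag p hp (by omega)]
    · simp [hne]
  | relEps x y =>
    replace hL : Matched n 1 L := hL
    obtain ⟨p, hp, i, w, hi, h, h'⟩ := ha x
    obtain ⟨p₂, hp₂, i₂, s, hi₂, h₂, h₂'⟩ := hb y
    simp only [Sat, h, h', h₂, h₂', RelModel.layered_eps_iff]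
    rcases eq_or_ne i i₂ with rfl | hne
    · exact and_congr_left fun _ => hL.eq_iff p hp p₂ hp₂ (by omega) (by omega)
    · simp [hne]
  | eqW x y =>
    replace hL : Matched n 1 L := hL
    obtain ⟨p, hp, i, w, hi, h, h'⟩ := ha x
    obtain ⟨p₂, hp₂, i₂, w₂, hi₂, h₂, h₂'⟩ := ha y
    simp only [Sat, h, h', h₂, h₂', RelModel.layeredWorld_eq_iff]
    rcases eq_or_ne i i₂ with rfl | hne
    · exact and_congr_left fun _ => hL.eq_iff p hp p₂ hp₂ (by omega) (by omega)
    · simp [hne]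
  | eqS x y =>
    replace hL : Matched n 1 L := hL
    obtain ⟨p, hp, i, s, hi, h, h'⟩ := hb x
    obtain ⟨p₂, hp₂, i₂, s₂, hi₂, h₂, h₂'⟩ := hb y
    simp only [Sat, h, h', h₂, h₂', RelModel.layeredState_eq_iff]
    refine or_congr_right ?_
    rcases eq_or_ne i i₂ with rfl | hne
    · exact and_congr_left fun _ => hL.eq_iff p hp p₂ hp₂ (by omega) (by omega)
    · simp [hne]
  | falsum => exact Iff.rfl
  | imp φ ψ h₁ h₂ =>
    have r₁ : φ.rank ≤ (φ.imp ψ).rank := le_max_left _ _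
    have r₂ : ψ.rank ≤ (φ.imp ψ).rank := le_max_right _ _
    exact imp_congr
      (h₁ (hL.mono (Nat.pow_le_pow_right two_pos r₁)) (by omega) ha hb)
      (h₂ (hL.mono (Nat.pow_le_pow_right two_pos r₂)) (by omega) ha hb)
  | allW φ ih =>
    have hr : φ.allW.rank = φ.rank + 1 := rfl
    rw [hr, pow_succ'] at hL
    rw [hr] at hN
    have key : ∀ (c c' : Copy N) (i : Fin (n + 1)) (w : M.W),
        Matched n (2 ^ φ.rank) ((c, c', (i : ℕ)) :: L) →
        (φ.Sat (M.layered J N n) (Fin.snoc a (M.layeredWorld J c i w)) b ↔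
          φ.Sat (M.layered J N n) (Fin.snoc a' (M.layeredWorld J c' i w)) b') := by
      intro c c' i w hm
      refine ih hm (by simp; omega) (fun x => ?_) fun y => ?_
      · refine Fin.lastCases ?_ (fun x => ?_) x
        · exact ⟨_, List.mem_cons_self, i, w, rfl, by simp, by simp⟩
        · obtain ⟨p, hp, h⟩ := ha x
          exact ⟨p, List.mem_cons_of_mem _ hp, by simpa using h⟩
      · obtain ⟨p, hp, h⟩ := hb y
        exact ⟨p, List.mem_cons_of_mem _ hp, h⟩
    constructor
    · intro h w'
      obtain ⟨c', i, w, rfl⟩ := M.exists_eq_layeredWorld J w'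
      obtain ⟨c, hc⟩ := hL.exists_cons' (by omega) c' i
      exact (key c c' i w hc).1 (h _)
    · intro h w'
      obtain ⟨c, i, w, rfl⟩ := M.exists_eq_layeredWorld J w'
      obtain ⟨c', hc⟩ := hL.exists_cons (by omega) c i
      exact (key c c' i w hc).2 (h _)
  | allS φ ih =>
    have hr : φ.allS.rank = φ.rank + 1 := rfl
    rw [hr, pow_succ'] at hL
    rw [hr] at hN
    have key : ∀ (c c' : Copy N) (i : Fin (n + 1)) (s : M.S),
        Matched n (2 ^ φ.rank) ((c, c', (i : ℕ)) :: L) →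
        (φ.Sat (M.layered J N n) a (Fin.snoc b (M.layeredState J c i s)) ↔
          φ.Sat (M.layered J N n) a' (Fin.snoc b' (M.layeredState J c' i s))) := by
      intro c c' i s hm
      refine ih hm (by simp; omega) (fun x => ?_) fun y => ?_
      · obtain ⟨p, hp, h⟩ := ha x
        exact ⟨p, List.mem_cons_of_mem _ hp, h⟩
      · refine Fin.lastCases ?_ (fun y => ?_) y
        · exact ⟨_, List.mem_cons_self, i, s, rfl, by simp, by simp⟩
        · obtain ⟨p, hp, h⟩ := hb y
          exact ⟨p, List.mem_cons_of_mem _ hp, by simpa using h⟩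
    constructor
    · intro h s'
      obtain ⟨c', i, s, rfl⟩ := M.exists_eq_layeredState J s'
      obtain ⟨c, hc⟩ := hL.exists_cons' (by omega) c' i
      exact (key c c' i s hc).1 (h _)
    · intro h s'
      obtain ⟨c, i, s, rfl⟩ := M.exists_eq_layeredState J s'
      obtain ⟨c', hc⟩ := hL.exists_cons (by omega) c i
      exact (key c c' i s hc).2 (h _)

/-- First-order formulae do not distinguish the copies of a state in the first layer. -/
theorem FO.sat_layeredState_iff (M : RelModel.{u, v} I) (J : Set I) (φ : FO I 0 1) (s : M.S)
    {N n : ℕ} (hN : φ.rank ≤ N) (hn : 2 ^ φ.rank < n) (c c' : Copy N) :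
    φ.Sat (M.layered J N n) ![] ![M.layeredState J c 0 s] ↔
      φ.Sat (M.layered J N n) ![] ![M.layeredState J c' 0 s] := by
  refine FO.sat_layered_iff M J φ (L := [(c, c', 0)]) ⟨?_, ?_⟩ (by simp; omega)
    (fun x => x.elim0) fun y => ?_
  · simp
  -- The flag clause is vacuous: layer `0` is farther than `2 ^ φ.rank` from layer `n`.
  · simpa using fun h => absurd h (by omega)
  · refine ⟨_, List.mem_singleton_self _, 0, s, rfl, ?_, ?_⟩ <;> simp

/-! ### Bisimulations of layered models -/

namespace Model

variable (M : Model.{u, v} I) (J : Set I) {N n : ℕ}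

/-- The restriction of the valuation to the atoms in `J`. -/
def restrict : Model.{u, v} I := { M with V := fun p => {w | p ∈ J ∧ w ∈ M.V p} }

/-- With flag `true` the last layer continues into itself, so forgetting copy and layer is a
bisimulation. -/
theorem worldBisim_layered (c : Copy N) (hc : c.2 = true) (i : Fin (n + 1)) (w : M.W) :
    WorldBisim (M.restrict J) w (M.layered J N n) (c, i, w) := by
  refine ⟨fun w x => x.1.2 = true ∧ x.2.2 = w,
    fun s t => ∃ (c : Copy N) (i : Fin (n + 1)), c.2 = true ∧ t = cell c i s, ?_, hc, rfl⟩
  refine ⟨?_, ?_, ?_, ?_, ?_⟩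
  · rintro _ ⟨c, i, w⟩ ⟨-, rfl⟩ p
    exact Iff.rfl
  · rintro s _ ⟨c, i, hc, rfl⟩ w hw
    exact ⟨(c, i, w), ⟨rfl, rfl, hw⟩, hc, rfl⟩
  · rintro s _ ⟨c, i, hc, rfl⟩ ⟨c', i', w⟩ ⟨rfl, rfl, hw⟩
    exact ⟨w, hw, hc, rfl⟩
  · rintro _ ⟨c, i, w⟩ ⟨hc, rfl⟩ s hs
    exact ⟨_, ⟨s, hs, Or.inr (Or.inr hc), rfl⟩, _, _, hc, rfl⟩
  · rintro _ ⟨c, i, w⟩ ⟨hc, rfl⟩ _ ⟨s, hs, -, rfl⟩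
    exact ⟨s, hs, _, _, hc, rfl⟩

theorem stateBisim_layered (c : Copy N) (hc : c.2 = true) (i : Fin (n + 1)) (s : Set M.W) :
    StateBisim (M.restrict J) s (M.layered J N n) (cell c i s) := by
  refine ⟨fun w hw => ⟨(c, i, w), ⟨rfl, rfl, hw⟩, M.worldBisim_layered J c hc i w⟩, ?_⟩
  rintro ⟨c', i', w⟩ ⟨rfl, rfl, hw⟩
  exact ⟨w, hw, M.worldBisim_layered J _ hc _ w⟩

variable {M J} {M' : Model.{u, v} I}

/-- From layer `i` of a cut-off copy only `n - i` steps remain, so agreement of types of level `n -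
i` is itself a bisimulation between worlds of the same layer. -/
theorem worldBisim_layered_of_tp_eq {c : Copy N} (hc : c.2 = false) {i : Fin (n + 1)} {w : M.W}
    {w' : M'.W} (h : M.tp J (n - i) w = M'.tp J (n - i) w') :
    WorldBisim (M.layered J N n) (c, i, w) (M'.layered J N n) (c, i, w') := by
  refine ⟨fun x x' => x.1 = c ∧ x'.1 = c ∧ x'.2.1 = x.2.1 ∧
      M.tp J (n - x.2.1) x.2.2 = M'.tp J (n - x.2.1) x'.2.2,
    fun s s' => ∃ (i : Fin (n + 1)) (t : Set M.W) (t' : Set M'.W),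
      s = cell c i t ∧ s' = cell c i t' ∧ M.tp J (n - i) '' t = M'.tp J (n - i) '' t',
    ?_, rfl, rfl, rfl, h⟩
  clear h w w' i
  have hforth : ∀ {M M' : Model.{u, v} I} {i : Fin (n + 1)} {w : M.W} {w' : M'.W},
      M.tp J (n - i) w = M'.tp J (n - i) w' →
      ∀ t ∈ M.Sig w, (t = ∅ ∨ (i : ℕ) < n ∨ c.2 = true) →
        ∃ t' ∈ M'.Sig w', (t' = ∅ ∨ (i : ℕ) < n ∨ c.2 = true) ∧
          M.tp J (n - nextLayer i) '' t = M'.tp J (n - nextLayer i) '' t' := by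
    intro M M' i w w' h t ht ht'
    by_cases hi : (i : ℕ) < n
    · have hsub : n - (i : ℕ) = (n - (nextLayer i : ℕ)) + 1 := by
        simp only [nextLayer]
        omega
      rw [hsub] at h
      obtain ⟨t', ht', h⟩ := exists_mem_Sig_of_tp_eq h ht
      exact ⟨t', ht', Or.inr (Or.inl hi), h⟩
    -- In the last layer of a copy with flag `false` only the empty state is available.
    · obtain rfl : t = ∅ := by simpa [hi, hc] using ht'
      exact ⟨∅, M'.empty_mem_Sig w', Or.inl rfl, by simp⟩
  refine ⟨?_, ?_, ?_, ?_, ?_⟩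
  · rintro ⟨_, i, w⟩ ⟨_, _, w'⟩ ⟨rfl, rfl, rfl, h⟩ p
    refine and_congr_right fun hp => ?_
    exact Set.ext_iff.1 (atomsAt_eq_of_tp_eq h) ⟨p, hp⟩
  · rintro _ _ ⟨i, t, t', rfl, rfl, h⟩ ⟨_, _, w⟩ ⟨rfl, rfl, hw⟩
    obtain ⟨w', hw', heq⟩ := h.subset (Set.mem_image_of_mem _ hw)
    exact ⟨(_, _, w'), ⟨rfl, rfl, hw'⟩, rfl, rfl, rfl, heq.symm⟩
  · rintro _ _ ⟨i, t, t', rfl, rfl, h⟩ ⟨_, _, w'⟩ ⟨rfl, rfl, hw'⟩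
    obtain ⟨w, hw, heq⟩ := h.symm.subset (Set.mem_image_of_mem _ hw')
    exact ⟨(_, _, w), ⟨rfl, rfl, hw⟩, rfl, rfl, rfl, heq⟩
  · rintro ⟨_, i, w⟩ ⟨_, _, w'⟩ ⟨rfl, rfl, rfl, h⟩ _ ⟨t, ht, ht', rfl⟩
    obtain ⟨t', h₁, h₂, h₃⟩ := hforth h t ht ht'
    exact ⟨_, ⟨t', h₁, h₂, rfl⟩, _, t, t', rfl, rfl, h₃⟩
  · rintro ⟨_, i, w⟩ ⟨_, _, w'⟩ ⟨rfl, rfl, rfl, h⟩ _ ⟨t, ht, ht', rfl⟩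
    obtain ⟨t', h₁, h₂, h₃⟩ := hforth h.symm t ht ht'
    exact ⟨_, ⟨t', h₁, h₂, rfl⟩, _, t', t, rfl, rfl, h₃.symm⟩

theorem stateBisim_layered_of_image_tp_eq {c : Copy N} (hc : c.2 = false) {s : Set M.W}
    {s' : Set M'.W} (h : M.tp J n '' s = M'.tp J n '' s') :
    StateBisim (M.layered J N n) (cell c 0 s) (M'.layered J N n) (cell c 0 s') := by
  constructor
  · rintro ⟨_, _, w⟩ ⟨rfl, rfl, hw⟩
    obtain ⟨w', hw', heq⟩ := h.subset (Set.mem_image_of_mem _ hw)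
    exact ⟨(_, _, w'), ⟨rfl, rfl, hw'⟩, worldBisim_layered_of_tp_eq hc heq.symm⟩
  · rintro ⟨_, _, w'⟩ ⟨rfl, rfl, hw'⟩
    obtain ⟨w, hw, heq⟩ := h.symm.subset (Set.mem_image_of_mem _ hw')
    exact ⟨(_, _, w), ⟨rfl, rfl, hw⟩, worldBisim_layered_of_tp_eq hc heq⟩

end Model

/-! ### The characterisation -/

/-! ### State-pointed properties -/

namespace StateProperty

variable {C : ModelClass} {Q : StateProperty.{u, v} I}

/-- First-order bisimulation invariant properties are invariant under some finite level of
bisimilarity over finitely many atoms. -/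
theorem exists_invariant_tp (hFO : Q.FODefinable C) (hB : Q.BisimInvariant C) :
    ∃ (J : Set I) (n : ℕ), J.Finite ∧ ∀ M N : RelModel.{u, v} I, C.Contains M → C.Contains N →
      ∀ (s : M.S) (s' : N.S),
        M.star.tp J n '' M.ext s = N.star.tp J n '' N.ext s' → (Q M s ↔ Q N s') := by
  obtain ⟨φ, hφ⟩ := hFO
  let J := φ.atoms
  -- The least depth at which the game started in layer `0` cannot be affected by the last layer
  -- under the bound `2 ^ φ.rank`.
  let n := 2 ^ φ.rank + 1
  have hlay : ∀ (M : RelModel.{u, v} I) (_ : C.Contains M) (s : M.S),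
      Q M s ↔ Q (M.layered J φ.rank n) (M.layeredState J (0, false) 0 s) := by
    intro M hM s
    have hMl := RelModel.contains_layered hM J φ.rank n
    have hMr := RelModel.contains_restrict hM J
    -- The game moves the state from a cut-off copy to a looping copy of the same structure, and the
    -- latter is bisimilar to the reduct of `M` to `J`.
    rw [hφ M hM, hφ _ hMl, FO.sat_layeredState_iff M J φ s le_rfl (Nat.lt_succ_self _) _ (0, true),
      ← hφ _ hMl]
    refine (FO.sat_restrict M φ subset_rfl ![] ![s]).symm.trans ((hφ _ hMr s).symm.trans ?_)
    refine hB _ _ hMr hMl s _ ?_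
    exact (M.star.stateBisim_layered J (0, true) rfl 0 (M.ext s)).ofModel
  refine ⟨J, n, φ.finite_atoms, fun M N hM hN s s' h => ?_⟩
  rw [hlay M hM, hlay N hN]
  refine hB _ _ (RelModel.contains_layered hM J _ n) (RelModel.contains_layered hN J _ n) _ _ ?_
  exact (Model.stateBisim_layered_of_image_tp_eq rfl h).ofModel.symm.ofModel.symm

/-- If the types realised in `s` are among those of an instance `t`, then they are exactly the types
of some substate of `t`. That substate has `Q` by downward closure, and `s` inherits it by
invariance under types. -/
theorem inqDefinable_of_foDefinable (hFO : Q.FODefinable C) (hne : Q.NonemptyOver C)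
    (hdown : Q.DownwardClosed C) (hB : Q.BisimInvariant C) : Q.InqDefinable C := by
  obtain ⟨J, n, hJ, hinv⟩ := exists_invariant_tp hFO hB
  obtain ⟨φ, hφ⟩ := exists_form_supports_iff_image_tp_subset.{u, v} hJ n
    {X | ∃ (M : RelModel.{u, v} I) (_ : C.Contains M) (s : M.S),
      Q M s ∧ X = M.star.tp J n '' M.ext s}
  refine ⟨φ, fun M hM s => Iff.trans ?_ (hφ M.star (M.ext s)).symm⟩
  have hsub : ∀ (N : RelModel.{u, v} I) (_ : C.Contains N) (t : N.S), Q N t →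
      M.star.tp J n '' M.ext s ⊆ N.star.tp J n '' N.ext t → Q M s := by
    intro N hN t ht h
    obtain ⟨r, hr, hr'⟩ := Set.subset_image_iff.1 h
    obtain ⟨r, rfl⟩ := N.exists_ext_eq_of_subset hr
    exact (hinv M N hM hN s r hr'.symm).2 (hdown N hN t r hr ht)
  constructor
  · exact fun h => Or.inr ⟨_, ⟨M, hM, s, h, rfl⟩, subset_rfl⟩
  · rintro (h | ⟨_, ⟨N, hN, t, ht, rfl⟩, h⟩)
    -- Every formula is supported by the empty state, so `Q` must hold there; any instance of `Q`
    -- provides this.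
    · obtain ⟨N, hN, t, ht⟩ := hne
      exact hsub N hN t ht (by simp [h])
    · exact hsub N hN t ht h

theorem exists_relModel (C : ModelClass) : ∃ M : RelModel.{u, v} I, C.Contains M := by
  let M : Model.{u, v} I :=
    { W := PUnit
      Sig := fun _ => Set.univ
      sig_nonempty := fun _ => Set.univ_nonempty
      sig_down := fun _ _ _ _ _ => trivial
      V := fun _ => ∅ }
  have : Finite M.W := inferInstanceAs (Finite PUnit)
  let N : RelModel.{u, v} I := RelModel.ofModel M ⟨PUnit.unit⟩ Set.univ (fun _ _ _ _ => trivial)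
    fun _ => Set.subset_univ _
  have hfin : N.IsFinite := RelModel.isFinite_ofModel
  have hfull : N.LocallyFull := RelModel.locallyFull_ofModel fun _ _ _ => trivial
  refine ⟨N, ?_⟩
  cases C with
  | all => trivial
  | finite => exact hfin
  | locallyFull => exact hfull
  | finiteLocallyFull => exact ⟨hfin, hfull⟩

theorem inqDefinable_iff : Q.InqDefinable C ↔
    Q.FODefinable C ∧ Q.NonemptyOver C ∧ Q.DownwardClosed C ∧ Q.BisimInvariant C := by
  refine ⟨fun h => ⟨h.foDefinable, ?_⟩, fun h =>
    inqDefinable_of_foDefinable h.1 h.2.1 h.2.2.1 h.2.2.2⟩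
  obtain ⟨φ, hφ⟩ := h
  refine ⟨?_, fun M hM s t hts h => ?_, fun M N hM hN s s' h => ?_⟩
  · obtain ⟨M, hM⟩ := exists_relModel.{u, v} (I := I) C
    obtain ⟨s⟩ := M.nonempty_S
    obtain ⟨t, ht⟩ := M.exists_ext_eq_of_subset (Set.empty_subset (M.ext s))
    refine ⟨M, hM, t, (hφ M hM t).2 ?_⟩
    rw [ht]
    exact M.star.supports_empty φ
  · exact (hφ M hM t).2 (((hφ M hM s).1 h).mono hts)
  · rw [hφ M hM, hφ N hN]
    exact h.supports_iff φ

end StateProperty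

/-! ### World-pointed properties -/

namespace WorldProperty

variable {C : ModelClass} {Q : WorldProperty.{u, v} I}

/-- The property of states that all their worlds have the property `Q`. -/
def onStates (Q : WorldProperty.{u, v} I) : StateProperty.{u, v} I :=
  fun M s => ∀ w ∈ M.ext s, Q M w

theorem inqDefinable_onStates (hFO : Q.FODefinable C) (hB : Q.BisimInvariant C) :
    Q.onStates.InqDefinable C := by
  refine StateProperty.inqDefinable_of_foDefinable ?_ ?_ ?_ ?_
  · obtain ⟨φ, hφ⟩ := hFO
    refine ⟨φ.onState 0, fun M hM s => ?_⟩
    rw [FO.sat_onState]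
    exact forall₂_congr fun w _ => hφ M hM w
  · obtain ⟨M, hM⟩ := StateProperty.exists_relModel.{u, v} (I := I) C
    obtain ⟨s⟩ := M.nonempty_S
    obtain ⟨t, ht⟩ := M.exists_ext_eq_of_subset (Set.empty_subset (M.ext s))
    refine ⟨M, hM, t, fun w hw => ?_⟩
    rw [ht] at hw
    exact hw.elim
  · exact fun M _ s t hts h w hw => h w (hts hw)
  · intro M N hM hN s s' h
    constructor
    · intro hs w' hw'
      obtain ⟨w, hw, hb⟩ := h.2 w' hw'
      exact (hB M N hM hN w w' hb).1 (hs w hw)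
    · intro hs w hw
      obtain ⟨w', hw', hb⟩ := h.1 w hw
      exact (hB M N hM hN w w' hb).2 (hs w' hw')

theorem _root_.Inq.Model.WorldBisim.refl (M : Model.{u, v} I) (w : M.W) :
    Model.WorldBisim M w M w :=
  ⟨Eq, Eq,
    { atoms := by rintro w _ rfl p; rfl
      state_forth := by rintro s _ rfl w hw; exact ⟨w, hw, rfl⟩
      state_back := by rintro s _ rfl w hw; exact ⟨w, hw, rfl⟩
      world_forth := by rintro w _ rfl s hs; exact ⟨s, hs, rfl⟩
      world_back := by rintro w _ rfl s hs; exact ⟨s, hs, rfl⟩ }, rfl⟩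

/-- A formula defining `Q.onStates` has, at a singleton state, the truth condition wanted for `Q`.
-/
theorem inqDefinable_iff : Q.InqDefinable C ↔ Q.FODefinable C ∧ Q.BisimInvariant C := by
  constructor
  · intro h
    refine ⟨h.foDefinable, ?_⟩
    obtain ⟨φ, hφ⟩ := h
    intro M N hM hN w w' hw
    rw [hφ M hM, hφ N hN]
    exact hw.truth_iff φ
  · rintro ⟨hFO, hB⟩
    obtain ⟨φ, hφ⟩ := inqDefinable_onStates hFO hB
    refine ⟨φ, fun M hM w => ?_⟩
    -- The singleton `{w}` need not be a state of `M`; adding it stays within the class and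
    -- preserves the bisimulation type of `w`.
    have hM' := RelModel.contains_addSingleton hM w
    have hb : Model.WorldBisim M.star w (M.addSingleton w).star w :=
      (Model.WorldBisim.refl M.star w).ofModel
    let s : (M.addSingleton w).S := ⟨{w}, Or.inr rfl⟩
    have hs : Q.onStates (M.addSingleton w) s ↔ Q (M.addSingleton w) w :=
      ⟨fun h => h w rfl, fun h x (hx : x = w) => hx ▸ h⟩
    rw [hB M _ hM hM' w w hb, ← hs, hφ _ hM' s]
    exact (hb.truth_iff φ).symm

end WorldProperty

end Inq

theorem mainTheorem3 {I : Type v} (C : Inq.ModelClass) :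
    (∀ Q : Inq.WorldProperty.{u, v} I,
      Inq.WorldProperty.InqDefinable C Q ↔
        Inq.WorldProperty.FODefinable C Q ∧ Inq.WorldProperty.BisimInvariant C Q) ∧
    (∀ Q : Inq.StateProperty.{u, v} I,
      Inq.StateProperty.InqDefinable C Q ↔
        Inq.StateProperty.FODefinable C Q ∧ Inq.StateProperty.NonemptyOver C Q ∧
          Inq.StateProperty.DownwardClosed C Q ∧ Inq.StateProperty.BisimInvariant C Q) :=
  ⟨fun _ => Inq.WorldProperty.inqDefinable_iff, fun _ => Inq.StateProperty.inqDefinable_iff⟩
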